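/- Let $k$ be a field, $q\in k$, $q\neq 0$, $q^2\ne 1$, and $n\ge 0$. Put $[m]_q=\frac{q^m-q^{-m}}{q-q^{-1}}$, $[m]_q!=[1]_q\cdots[m]_q$. Let $B_{n+1}$ be the braid group with Artin generators $\sigma_1,\dots,\sigma_n$. The Hecke algebra $H_{n+1}(q)$ is the quotient of $kB_{n+1}$ by $\sigma_i^2=(q-q^{-1})\sigma_i+1$; in it put $\sigma_i(x)=\frac{1}{q-q^{-1}}(x\sigma_i-x^{-1}\sigma_i^{-1})$. For $\nu\in k\setminus\{0,q,-q^{-1}\}$ the algebra $BMW_{n+1}(q,\nu)$ is the quotient of $kB_{n+1}$ by $\kappa_i\sigma_i=\sigma_i\kappa_i=\nu\kappa_i$, $\kappa_i\sigma_{i-1}\kappa_i=\nu^{-1}\kappa_i$, $\kappa_i\sigma_{i-1}^{-1}\kappa_i=\nu\kappa_i$, where $\kappa_i$ is defined by $\sigma_i-\sigma_i^{-1}=(q-q^{-1})(1-\kappa_i)$; in it put $\sigma_i(x)=x^{-1}\bigl(1+\frac{x^2-1}{q-q^{-1}}\sigma_i+\frac{x^2-1}{1-\nu^{-1}q^{-1}x^2}\kappa_i\bigr)$.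 In the BMW case assume $\nu\neq q^{2j-1}$ for $1\le j\le n$, so that $\sigma_j(q^j)$ is defined. Let $A$ be $H_{n+1}(q)$ or $BMW_{n+1}(q,\nu)$, and let $T={}^q\mathrm{Ш}_{1,n}=\sigma_1(q)\sigma_2(q^2)\cdots\sigma_n(q^n)\in A$ be the multiplicative 1-shuffle. For $u\in A$ let $L_u$ be left multiplication by $u$ on $A$; $u$ is called semisimple if $L_u$ is a semisimple operator. The semisimple part of $u$ is the semisimple $s\in A$ commuting with $u$ such that $u-s$ is nilpotent. Then $$T^n\,(T-[n+1]_q!)=0 .$$ Suppose moreover that $[n+1]_q!\neq 0$. Then: 1. The minimal polynomial of $T$ over $k$ is $t^n(t-[n+1]_q!)$. 2. If $n>1$, then $T$ is not semisimple. 3. There is exactly one symmetrizer $S_{n+1}\in A$, i.e. a non-zero idempotent with $\sigma_iS_{n+1}=S_{n+1}\sigma_i=qS_{n+1}$ for $i=1,\dots,n$; and $T$ has a unique semisimple part, namely $[n+1]_q!\,S_{n+1}$. 4. $[n+1]_q!$ is a simple eigenvalue of $L_T$: its generalized eigenspace in $A$ is one-dimensional. -/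

import Mathlib

noncomputable section

/-- The Artin relations among `M` generators `σ_1, …, σ_M` (the generator `σ_{i+1}` has index
`i : Fin M`). -/
def artinRels (M : ℕ) : Set (FreeGroup (Fin M)) :=
  {r | (∃ i j : Fin M, (i : ℕ) + 1 = (j : ℕ) ∧
          r = (FreeGroup.of i * FreeGroup.of j * FreeGroup.of i) *
              (FreeGroup.of j * FreeGroup.of i * FreeGroup.of j)⁻¹) ∨
       (∃ i j : Fin M, (i : ℕ) + 1 < (j : ℕ) ∧
          r = (FreeGroup.of i * FreeGroup.of j) * (FreeGroup.of j * FreeGroup.of i)⁻¹)}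

/-- The braid group `B_{M+1}` on `M + 1` strands, with its `M` Artin generators. -/
abbrev BraidGroup (M : ℕ) : Type := PresentedGroup (artinRels M)

/-- The generator `σ_{i+1}` of the braid group. -/
def braidGen {M : ℕ} (i : Fin M) : BraidGroup M := PresentedGroup.of i

/-- The group ring `k B_{M+1}`. -/
abbrev BraidRing (k : Type*) [Field k] (M : ℕ) := MonoidAlgebra k (BraidGroup M)

/-- A braid as an element of the group ring. -/
abbrev toBraidRing (k : Type*) [Field k] {M : ℕ} (b : BraidGroup M) : BraidRing k M :=
  MonoidAlgebra.of k (BraidGroup M) b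

/-- The `q`-number `[n]_q = (q^n - q^{-n}) / (q - q^{-1})`. -/
def qNum {k : Type*} [Field k] (q : k) (n : ℕ) : k := (q ^ n - (q ^ n)⁻¹) / (q - q⁻¹)

/-- The `q`-factorial `[n]_q! = [1]_q [2]_q ⋯ [n]_q`. -/
def qFact {k : Type*} [Field k] (q : k) (n : ℕ) : k := ∏ j ∈ Finset.Icc 1 n, qNum q j

/-! ### Hecke algebras -/

/-- The Hecke relations `σ_i² = (q - q⁻¹) σ_i + 1`. -/
inductive HeckeRel {k : Type*} [Field k] (q : k) (M : ℕ) : BraidRing k M → BraidRing k M → Prop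
  | quad (i : Fin M) :
      HeckeRel q M (toBraidRing k (braidGen i) * toBraidRing k (braidGen i))
        ((q - q⁻¹) • toBraidRing k (braidGen i) + 1)

/-- The Hecke algebra `H_{M+1}(q)`, the quotient of `k B_{M+1}` by the Hecke relations. -/
abbrev HeckeAlg {k : Type*} [Field k] (q : k) (M : ℕ) := RingQuot (HeckeRel q M)

/-- The image of a braid in the Hecke algebra. -/
def heckeOf {k : Type*} [Field k] (q : k) {M : ℕ} (b : BraidGroup M) : HeckeAlg q M :=
  RingQuot.mkAlgHom k (HeckeRel q M) (toBraidRing k b)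

/-- The generator `σ_{i+1}` of the Hecke algebra. -/
def heckeGen {k : Type*} [Field k] (q : k) {M : ℕ} (i : Fin M) : HeckeAlg q M :=
  heckeOf q (braidGen i)

/-- The baxterized element `σ_{i+1}(x) = (x σ_{i+1} - x⁻¹ σ_{i+1}⁻¹) / (q - q⁻¹)`. -/
def heckeBaxter {k : Type*} [Field k] (q : k) {M : ℕ} (i : Fin M) (x : k) : HeckeAlg q M :=
  (q - q⁻¹)⁻¹ • (x • heckeOf q (braidGen i) - x⁻¹ • heckeOf q (braidGen i)⁻¹)

/-- The multiplicative 1-shuffle `σ_1(q) σ_2(q²) ⋯ σ_n(qⁿ)` in `H_{n+1}(q)`. -/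
def heckeShuffle {k : Type*} [Field k] (q : k) (n : ℕ) : HeckeAlg q n :=
  (List.ofFn fun i : Fin n => heckeBaxter q i (q ^ ((i : ℕ) + 1))).prod

/-! ### BMW algebras -/

/-- `κ_{i+1}` in the braid group ring, determined by
`σ_{i+1} - σ_{i+1}⁻¹ = (q - q⁻¹) (1 - κ_{i+1})` for `q² ≠ 1`. -/
def braidKappa {k : Type*} [Field k] (q : k) {M : ℕ} (i : Fin M) : BraidRing k M :=
  1 - (q - q⁻¹)⁻¹ • (toBraidRing k (braidGen i) - toBraidRing k (braidGen i)⁻¹)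

/-- The Birman–Murakami–Wenzl relations. -/
inductive BMWRel {k : Type*} [Field k] (q ν : k) (M : ℕ) :
    BraidRing k M → BraidRing k M → Prop
  | kappa_gen (i : Fin M) :
      BMWRel q ν M (braidKappa q i * toBraidRing k (braidGen i)) (ν • braidKappa q i)
  | gen_kappa (i : Fin M) :
      BMWRel q ν M (toBraidRing k (braidGen i) * braidKappa q i) (ν • braidKappa q i)
  | tangle (i j : Fin M) (h : (i : ℕ) + 1 = (j : ℕ)) :
      BMWRel q ν M (braidKappa q j * toBraidRing k (braidGen i) * braidKappa q j)
        (ν⁻¹ • braidKappa q j)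
  | tangle_inv (i j : Fin M) (h : (i : ℕ) + 1 = (j : ℕ)) :
      BMWRel q ν M (braidKappa q j * toBraidRing k (braidGen i)⁻¹ * braidKappa q j)
        (ν • braidKappa q j)

/-- The algebra `BMW_{M+1}(q, ν)`, the quotient of `k B_{M+1}` by the BMW relations. -/
abbrev BMWAlg {k : Type*} [Field k] (q ν : k) (M : ℕ) := RingQuot (BMWRel q ν M)

/-- The generator `σ_{i+1}` of the BMW algebra. -/
def bmwGen {k : Type*} [Field k] (q ν : k) {M : ℕ} (i : Fin M) : BMWAlg q ν M :=
  RingQuot.mkAlgHom k (BMWRel q ν M) (toBraidRing k (braidGen i))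

/-- The element `κ_{i+1}` of the BMW algebra. -/
def bmwKappa {k : Type*} [Field k] (q ν : k) {M : ℕ} (i : Fin M) : BMWAlg q ν M :=
  RingQuot.mkAlgHom k (BMWRel q ν M) (braidKappa q i)

/-- The baxterized element
`σ_i(x) = x⁻¹ (1 + (x² - 1)/(q - q⁻¹) σ_i + (x² - 1)/(1 - ν⁻¹ q⁻¹ x²) κ_i)`. -/
def bmwBaxter {k : Type*} [Field k] (q ν : k) {M : ℕ} (i : Fin M) (x : k) : BMWAlg q ν M :=
  x⁻¹ • (1 + ((x ^ 2 - 1) / (q - q⁻¹)) • bmwGen q ν i +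
    ((x ^ 2 - 1) / (1 - ν⁻¹ * q⁻¹ * x ^ 2)) • bmwKappa q ν i)

/-- The multiplicative 1-shuffle `σ_1(q) σ_2(q²) ⋯ σ_n(qⁿ)` in `BMW_{n+1}(q, ν)`. -/
def bmwShuffle {k : Type*} [Field k] (q ν : k) (n : ℕ) : BMWAlg q ν n :=
  (List.ofFn fun i : Fin n => bmwBaxter q ν i (q ^ ((i : ℕ) + 1))).prod

/-! ### Symmetrizers, semisimple parts, simple eigenvalues -/

/-- `S` is a symmetrizer for the generators `σ_1, …, σ_M` of the `k`-algebra `A`: a non-zero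
idempotent with `σ_i S = S σ_i = q S` for all `i`. -/
def IsSymmetrizer {k A : Type*} [Field k] [Ring A] [Algebra k A] (q : k) {M : ℕ}
    (σ : Fin M → A) (S : A) : Prop :=
  S ≠ 0 ∧ (∀ i, σ i * S = q • S ∧ S * σ i = q • S) ∧ S * S = S

/-- The operator `L_u` of left multiplication by `u`. -/
abbrev leftMul (k : Type*) {A : Type*} [Field k] [Ring A] [Algebra k A] (u : A) :
    Module.End k A :=
  LinearMap.mulLeft k u

/-- The element `u` is semisimple: `L_u` is a semisimple operator. -/
def IsSemisimpleElt (k : Type*) {A : Type*} [Field k] [Ring A] [Algebra k A] (u : A) : Prop :=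
  (leftMul k u).IsSemisimple

/-- `s` is the semisimple part of `u` in a Jordan–Chevalley decomposition: `s` is semisimple,
commutes with `u`, and `u - s` is nilpotent. -/
def IsSemisimplePart (k : Type*) {A : Type*} [Field k] [Ring A] [Algebra k A] (u s : A) : Prop :=
  IsSemisimpleElt k s ∧ Commute s u ∧ IsNilpotent (u - s)

/-- `c` is an eigenvalue of `L_u` of algebraic multiplicity one: its generalized eigenspace is
a line. -/
def IsSimpleEigenvalue (k : Type*) {A : Type*} [Field k] [Ring A] [Algebra k A]
    (u : A) (c : k) : Prop :=
  Module.finrank k ((leftMul k u).maxGenEigenspace c) = 1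

end

/-!
The Hecke and BMW algebras are treated together through `IsBMWSystem`, a list of relations between
elements `σ_i`, `σ_i⁻¹`, `κ_i` of an algebra `A`; the Hecke algebra is the case `κ = 0`. Write
`T = σ_1(q) ⋯ σ_n(qⁿ)` and `c = [n + 1]_q!`.

*Annihilating polynomial.* One has `σ_1 T = q T`, because `(σ_1 - q) σ_1(q) = 0`. If `σ_i X = q X`
then `σ_{i+1} T X = q T X`; this is the Yang–Baxter equation with spectral parameters `q⁻¹`, `qⁱ`,
`q^{i+1}`, in a form that does not involve `σ_i(q⁻¹)`, which need not be defined
(`IsBMWSystem.gen_mul_baxterize_mul_baxterize`). Hence `σ_i T ^ m = q T ^ m` for `i ≤ m`, so that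
`T ^ n` is a `q`-eigenvector of all generators, on which every `σ_i(qⁱ)` acts by `[i + 1]_q`, and
`T ^ (n + 1) = c T ^ n`.

*Symmetrizer.* Let `c ≠ 0`. Then `T ^ n / cⁿ` is a left symmetrizer. The relations are symmetric
under reversal of products, so there is a right symmetrizer too, and since `A` acts on both through
the character `χ : σ_i ↦ q`, they coincide (`IsBMWSystem.exists_symmetrizer`). Thus `T ^ n = cⁿ S`
with `a S = S a = χ(a) S` for all `a`. This determines the semisimple part and the generalized
eigenspace for `c`: `T` acts on the line `S A` by `c` and is nilpotent on `(1 - S) A`.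

*Minimal polynomial.* It remains to see that `T ^ (n - 1) (T - c) ≠ 0`. It suffices to do so in the
Hecke algebra, a quotient of the BMW algebra, and there in the representation on `k^{n+1}`
deforming the permutation representation. In it the invariants form a line, and `T` has kernel of
dimension one since only its first factor `σ_1(q)` is singular
(`hecke_shuffle_pow_mul_sub_ne_zero`).
-/

open Polynomial

/-! ### Birman–Murakami–Wenzl relations in an arbitrary algebra -/

/-- Elements `σ_i`, `τ_i`, `κ_i` of a `k`-algebra satisfy the BMW relations; `τ_i` stands for
`σ_i⁻¹`. The family `κ = 0` is allowed, in which case these are the relations of the Hecke algebra.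
The relations are stable under reversing the multiplication. The last condition makes the
coefficients of the baxterized elements at `x = q, …, q ^ M` meaningful where they matter. -/
structure IsBMWSystem {k A : Type*} [Field k] [Ring A] [Algebra k A] (q ν : k) {M : ℕ}
    (σ τ κ : Fin M → A) : Prop where
  q_ne : q ≠ 0
  q_sq_ne : q ^ 2 ≠ 1
  ν_ne : ν ≠ 0
  gen_inv : ∀ i, σ i * τ i = 1
  inv_gen : ∀ i, τ i * σ i = 1
  skein : ∀ i, σ i - τ i = (q - q⁻¹) • (1 - κ i)
  kappa_gen : ∀ i, κ i * σ i = ν • κ i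
  gen_kappa : ∀ i, σ i * κ i = ν • κ i
  tangle : ∀ i j : Fin M, (i : ℕ) + 1 = j → κ j * σ i * κ j = ν⁻¹ • κ j
  tangle_inv : ∀ i j : Fin M, (i : ℕ) + 1 = j → κ j * τ i * κ j = ν • κ j
  braid : ∀ i j : Fin M, (i : ℕ) + 1 = j → σ i * σ j * σ i = σ j * σ i * σ j
  comm : ∀ i j : Fin M, (i : ℕ) + 1 < j → σ i * σ j = σ j * σ i
  generic : (∀ i, κ i = 0) ∨ (ν ≠ q ∧ ∀ i : Fin M, ν ≠ q ^ (2 * (i : ℕ) + 1))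

/-- The baxterized element `x⁻¹ (1 + (x² - 1)/(q - q⁻¹) s + (x² - 1)/(1 - ν⁻¹ q⁻¹ x²) c)` for
`s` in the role of `σ_i` and `c` in the role of `κ_i`. -/
def baxterize {k A : Type*} [Field k] [Ring A] [Algebra k A] (q ν : k) (s c : A) (x : k) : A :=
  x⁻¹ • (1 + ((x ^ 2 - 1) / (q - q⁻¹)) • s + ((x ^ 2 - 1) / (1 - ν⁻¹ * q⁻¹ * x ^ 2)) • c)

lemma sub_inv_eq_div {k : Type*} [Field k] {q : k} (hq : q ≠ 0) :
    q - q⁻¹ = (q ^ 2 - 1) / q := by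
  field_simp

lemma sub_inv_ne_zero_of_sq_ne_one {k : Type*} [Field k] {q : k} (hq : q ≠ 0) (hq2 : q ^ 2 ≠ 1) :
    q - q⁻¹ ≠ 0 := by
  rw [sub_inv_eq_div hq]
  exact div_ne_zero (sub_ne_zero.mpr hq2) hq

namespace IsBMWSystem

variable {k A : Type*} [Field k] [Ring A] [Algebra k A] {q ν : k} {M : ℕ} {σ τ κ : Fin M → A}

lemma lam_ne (h : IsBMWSystem q ν σ τ κ) : q - q⁻¹ ≠ 0 :=
  sub_inv_ne_zero_of_sq_ne_one h.q_ne h.q_sq_ne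

/-- The BMW relations are invariant under the anti-automorphism fixing the generators. -/
lemma op (h : IsBMWSystem q ν σ τ κ) :
    IsBMWSystem q ν (fun i => MulOpposite.op (σ i)) (fun i => MulOpposite.op (τ i))
      (fun i => MulOpposite.op (κ i)) where
  q_ne := h.q_ne
  q_sq_ne := h.q_sq_ne
  ν_ne := h.ν_ne
  gen_inv i := by rw [← MulOpposite.op_mul, h.inv_gen, MulOpposite.op_one]
  inv_gen i := by rw [← MulOpposite.op_mul, h.gen_inv, MulOpposite.op_one]
  skein i := by rw [← MulOpposite.op_sub, h.skein]; rfl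
  kappa_gen i := by rw [← MulOpposite.op_mul, h.gen_kappa, MulOpposite.op_smul]
  gen_kappa i := by rw [← MulOpposite.op_mul, h.kappa_gen, MulOpposite.op_smul]
  tangle i j hij := by
    rw [← MulOpposite.op_mul, ← MulOpposite.op_mul, ← mul_assoc, h.tangle i j hij,
      MulOpposite.op_smul]
  tangle_inv i j hij := by
    rw [← MulOpposite.op_mul, ← MulOpposite.op_mul, ← mul_assoc, h.tangle_inv i j hij,
      MulOpposite.op_smul]
  braid i j hij := by
    rw [← MulOpposite.op_mul, ← MulOpposite.op_mul, ← mul_assoc, h.braid i j hij,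
      ← MulOpposite.op_mul, ← MulOpposite.op_mul, ← mul_assoc]
  comm i j hij := by rw [← MulOpposite.op_mul, ← h.comm i j hij, MulOpposite.op_mul]
  generic := h.generic.imp_left fun h0 i => by simp [h0 i]

lemma inv_eq (h : IsBMWSystem q ν σ τ κ) (i : Fin M) :
    τ i = σ i - (q - q⁻¹) • (1 - κ i) := by
  rw [← h.skein i]; abel

lemma kappa_eq (h : IsBMWSystem q ν σ τ κ) (i : Fin M) :
    κ i = 1 - (q - q⁻¹)⁻¹ • (σ i - τ i) := by
  rw [h.skein i, smul_smul, inv_mul_cancel₀ h.lam_ne, one_smul]; abel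

lemma gen_mul_gen (h : IsBMWSystem q ν σ τ κ) (i : Fin M) :
    σ i * σ i = 1 + (q - q⁻¹) • σ i - ((q - q⁻¹) * ν) • κ i := by
  have h1 := congrArg (σ i * ·) (h.inv_eq i)
  simp only [h.gen_inv, mul_sub, mul_smul_comm, mul_one, h.gen_kappa] at h1
  rw [eq_sub_iff_add_eq] at h1
  rw [← h1]; module

/-- `σ_i` acts by `ν ≠ q` on multiples of `κ_i`, so `κ_i` kills its `q`-eigenvectors. -/
lemma kappa_mul_of_eigen (h : IsBMWSystem q ν σ τ κ) (i : Fin M) {X : A}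
    (hX : σ i * X = q • X) : κ i * X = 0 := by
  rcases h.generic with h0 | ⟨hν, -⟩
  · simp [h0 i]
  have h1 : ν • (κ i * X) = q • (κ i * X) := by
    rw [← smul_mul_assoc, ← h.kappa_gen, mul_assoc, hX, mul_smul_comm]
  rw [← sub_eq_zero, ← sub_smul] at h1
  exact (smul_eq_zero.mp h1).resolve_left (sub_ne_zero.mpr hν)

lemma conj_inv (h : IsBMWSystem q ν σ τ κ) (i j : Fin M) (hij : (i : ℕ) + 1 = j) :
    σ j * σ i * τ j = τ i * σ j * σ i := by
  calc σ j * σ i * τ j = τ i * (σ i * σ j * σ i) * τ j := by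
        simp only [← mul_assoc, h.inv_gen, one_mul]
    _ = τ i * σ j * σ i * (σ j * τ j) := by rw [h.braid i j hij]; simp only [mul_assoc]
    _ = _ := by rw [h.gen_inv, mul_one]

lemma conj_kappa (h : IsBMWSystem q ν σ τ κ) (i j : Fin M) (hij : (i : ℕ) + 1 = j) :
    σ j * σ i * κ j = κ i * σ j * σ i := by
  have hb := h.braid i j hij
  have hc := h.conj_inv i j hij
  simp only [h.kappa_eq, mul_sub, sub_mul, mul_one, one_mul, mul_smul_comm, smul_mul_assoc, hb, hc]

lemma conj_inv_kappa (h : IsBMWSystem q ν σ τ κ) (i j : Fin M) (hij : (i : ℕ) + 1 = j) :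
    τ j * τ i * κ j = κ i * τ j * τ i := by
  have hb : σ i * σ j * κ i = κ j * σ i * σ j := by
    have hb := h.braid i j hij
    have hc : σ i * σ j * τ i = τ j * σ i * σ j := by
      calc σ i * σ j * τ i = τ j * (σ j * σ i * σ j) * τ i := by
            simp only [← mul_assoc, h.inv_gen, one_mul]
        _ = τ j * σ i * σ j * (σ i * τ i) := by rw [← h.braid i j hij]; simp only [mul_assoc]
        _ = _ := by rw [h.gen_inv, mul_one]
    simp only [h.kappa_eq, mul_sub, sub_mul, mul_one, one_mul, mul_smul_comm, smul_mul_assoc,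
      hb, hc]
  calc τ j * τ i * κ j = τ j * τ i * (κ j * σ i * (σ j * τ j) * τ i) := by
        rw [h.gen_inv, mul_one, mul_assoc (κ j), h.gen_inv, mul_one]
    _ = τ j * τ i * (κ j * σ i * σ j) * τ j * τ i := by simp only [mul_assoc]
    _ = τ j * (τ i * σ i) * σ j * κ i * τ j * τ i := by rw [← hb]; simp only [mul_assoc]
    _ = _ := by rw [h.inv_gen, mul_one, h.inv_gen, one_mul]

/-- Expressing `κ_i κ_{i+1}` by braids and `κ_{i+1}` alone: conjugation by `σ_{i+1} σ_i` turns
`κ_{i+1}` into `κ_i`, and the tangle relation does the rest. -/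
lemma kappa_mul_kappa (h : IsBMWSystem q ν σ τ κ) (i j : Fin M) (hij : (i : ℕ) + 1 = j) :
    κ i * κ j = σ j * σ i * κ j := by
  have h1 : ν • (σ j * σ i * κ j) = ν • (κ i * κ j) := by
    calc ν • (σ j * σ i * κ j) = σ j * σ i * (κ j * τ i * κ j) := by
          rw [h.tangle_inv i j hij, mul_smul_comm]
      _ = σ j * σ i * κ j * τ i * κ j := by simp only [mul_assoc]
      _ = κ i * σ j * (σ i * τ i) * κ j := by
          rw [h.conj_kappa i j hij]; simp only [mul_assoc]
      _ = ν • (κ i * κ j) := by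
          rw [h.gen_inv, mul_one, mul_assoc, h.gen_kappa, mul_smul_comm]
  exact (smul_right_injective A h.ν_ne h1).symm

lemma kappa_mul_kappa_inv (h : IsBMWSystem q ν σ τ κ) (i j : Fin M) (hij : (i : ℕ) + 1 = j) :
    κ i * κ j = τ j * τ i * κ j := by
  have hτκ : τ j * κ j = ν⁻¹ • κ j := by
    have := congrArg (fun a => ν⁻¹ • (τ j * a)) (h.gen_kappa j)
    simpa [← mul_assoc, h.inv_gen, smul_smul, inv_mul_cancel₀ h.ν_ne] using this.symm
  have h1 : ν⁻¹ • (τ j * τ i * κ j) = ν⁻¹ • (κ i * κ j) := by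
    calc ν⁻¹ • (τ j * τ i * κ j) = τ j * τ i * (κ j * σ i * κ j) := by
          rw [h.tangle i j hij, mul_smul_comm]
      _ = τ j * τ i * κ j * σ i * κ j := by simp only [mul_assoc]
      _ = κ i * τ j * (τ i * σ i) * κ j := by
          rw [h.conj_inv_kappa i j hij]; simp only [mul_assoc]
      _ = ν⁻¹ • (κ i * κ j) := by
          rw [h.inv_gen, mul_one, mul_assoc, hτκ, mul_smul_comm]
  exact (smul_right_injective A (inv_ne_zero h.ν_ne) h1).symm

lemma gen_commute (h : IsBMWSystem q ν σ τ κ) {i j : Fin M}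
    (hij : (i : ℕ) + 1 < j ∨ (j : ℕ) + 1 < i) : Commute (σ i) (σ j) :=
  hij.elim (h.comm i j) fun hji => (h.comm j i hji).symm

lemma kappa_commute (h : IsBMWSystem q ν σ τ κ) {i j : Fin M}
    (hij : (i : ℕ) + 1 < j ∨ (j : ℕ) + 1 < i) : Commute (σ i) (κ j) := by
  have hτ : Commute (σ i) (τ j) :=
    let u : Aˣ := ⟨σ j, τ j, h.gen_inv j, h.inv_gen j⟩
    Commute.units_inv_right (u := u) (h.gen_commute hij)
  rw [h.kappa_eq j]
  exact (Commute.one_right _).sub_right (((h.gen_commute hij).sub_right hτ).smul_right _)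

lemma baxterize_commute (h : IsBMWSystem q ν σ τ κ) {i j : Fin M} (x : k)
    (hij : (i : ℕ) + 1 < j ∨ (j : ℕ) + 1 < i) :
    Commute (σ i) (baxterize q ν (σ j) (κ j) x) :=
  ((((Commute.one_right _).add_right ((h.gen_commute hij).smul_right _)).add_right
    ((h.kappa_commute hij).smul_right _))).smul_right _

/-- If `σ_i X = q X` then `σ_i(q ^ m)` acts on `X` as the `q`-number `[m + 1]_q`. -/
lemma baxterize_mul_of_eigen (h : IsBMWSystem q ν σ τ κ) (i : Fin M) (m : ℕ) {X : A}
    (hX : σ i * X = q • X) :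
    baxterize q ν (σ i) (κ i) (q ^ m) * X = qNum q (m + 1) • X := by
  have hq := h.q_ne
  have hl := sub_ne_zero.mpr h.q_sq_ne
  have hm : q ^ m ≠ 0 := pow_ne_zero _ hq
  simp only [baxterize, smul_mul_assoc, add_mul, one_mul, hX, h.kappa_mul_of_eigen i hX, qNum,
    sub_inv_eq_div hq]
  match_scalars
  simp only [pow_succ]
  generalize q ^ m = x at *
  field_simp
  ring

/-- The element `σ_i(q)` has its image in the `q`-eigenspace of `σ_i`. -/
lemma gen_mul_baxterize (h : IsBMWSystem q ν σ τ κ) (i : Fin M) :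
    σ i * baxterize q ν (σ i) (κ i) q = q • baxterize q ν (σ i) (κ i) q := by
  have hq := h.q_ne
  have hν := h.ν_ne
  have hl := sub_ne_zero.mpr h.q_sq_ne
  simp only [baxterize, mul_smul_comm, mul_add, mul_one, h.gen_mul_gen, h.gen_kappa]
  have key : ((q ^ 2 - 1) / (1 - ν⁻¹ * q⁻¹ * q ^ 2)) • ((ν - q) • κ i) =
      (ν * (q ^ 2 - 1)) • κ i := by
    rcases h.generic with h0 | ⟨hνq, -⟩
    · simp [h0 i]
    have hd : 1 - ν⁻¹ * q⁻¹ * q ^ 2 = (ν - q) / ν := by field_simp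
    have : ν - q ≠ 0 := sub_ne_zero.mpr hνq
    rw [hd, smul_smul]; congr 1; field_simp
  rw [sub_smul, smul_sub, sub_eq_iff_eq_add] at key
  simp only [smul_add, smul_sub]
  rw [key, sub_inv_eq_div hq]
  match_scalars <;> field_simp <;> ring

/-- The consequence of the Yang–Baxter equation on which the annihilating polynomial rests: left
multiplication by `σ_i(x) σ_{i+1}(q x)` carries the `q`-eigenvectors of `σ_i` to `q`-eigenvectors
of `σ_{i+1}`. It is checked on the span of `X`, `σ_{i+1} X`, `κ_{i+1} X`, `σ_i σ_{i+1} X`,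
`σ_i κ_{i+1} X`, `κ_i κ_{i+1} X`, which is stable under `σ_i` and `σ_{i+1}`; thus no genericity
of the parameters beyond the existence of the two baxterized elements is needed. -/
lemma gen_mul_baxterize_mul_baxterize (h : IsBMWSystem q ν σ τ κ) (i j : Fin M)
    (hij : (i : ℕ) + 1 = j) {X : A} (hX : σ i * X = q • X) :
    σ j * (baxterize q ν (σ i) (κ i) (q ^ ((i : ℕ) + 1)) *
      (baxterize q ν (σ j) (κ j) (q ^ ((j : ℕ) + 1)) * X)) =
    q • (baxterize q ν (σ i) (κ i) (q ^ ((i : ℕ) + 1)) *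
      (baxterize q ν (σ j) (κ j) (q ^ ((j : ℕ) + 1)) * X)) := by
  have hq := h.q_ne
  have hν := h.ν_ne
  have hl := sub_ne_zero.mpr h.q_sq_ne
  have e0 : κ i * X = 0 := h.kappa_mul_of_eigen i hX
  have e1 : σ j * (σ j * X) =
      X + (q - q⁻¹) • (σ j * X) - ((q - q⁻¹) * ν) • (κ j * X) := by
    rw [← mul_assoc, h.gen_mul_gen]; simp only [add_mul, sub_mul, one_mul, smul_mul_assoc]
  have e2 : σ j * (κ j * X) = ν • (κ j * X) := by
    rw [← mul_assoc, h.gen_kappa, smul_mul_assoc]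
  have e3 : σ j * (σ i * (σ j * X)) = q • (σ i * (σ j * X)) := by
    rw [← mul_assoc, ← mul_assoc, ← h.braid i j hij, mul_assoc, hX, mul_smul_comm, mul_assoc]
  have e4 : σ j * (σ i * (κ j * X)) = κ i * (κ j * X) := by
    rw [← mul_assoc, ← mul_assoc, ← h.kappa_mul_kappa i j hij, mul_assoc]
  have e5 : σ j * (κ i * (κ j * X)) =
      σ i * (κ j * X) - (q - q⁻¹) • (κ j * X) + (q - q⁻¹) • (κ i * (κ j * X)) := by
    have h1 : σ j * (κ i * κ j) = τ i * κ j := by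
      rw [h.kappa_mul_kappa_inv i j hij, mul_assoc (τ j), ← mul_assoc (σ j), h.gen_inv, one_mul]
    rw [← mul_assoc (κ i), ← mul_assoc, h1, h.inv_eq]
    simp only [sub_mul, smul_mul_assoc, one_mul, mul_assoc]
    module
  have e6 : κ i * (σ j * X) = q⁻¹ • (κ i * (κ j * X)) := by
    rw [← mul_assoc (κ i) (κ j), h.kappa_mul_kappa i j hij, h.conj_kappa i j hij,
      mul_assoc _ _ X, hX, mul_assoc, mul_smul_comm, mul_smul_comm, smul_smul,
      inv_mul_cancel₀ hq, one_smul]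
  have hx : q ^ ((i : ℕ) + 1) ≠ 0 := pow_ne_zero _ hq
  have hxj : q ^ ((j : ℕ) + 1) = q * q ^ ((i : ℕ) + 1) := by rw [← hij]; ring
  rw [sub_inv_eq_div hq] at e1 e5
  rw [hxj]
  simp only [baxterize, smul_mul_assoc, mul_smul_comm, add_mul, mul_add, one_mul, hX, e0, smul_zero,
    add_zero, e1, e2, e3, e4, e5, e6,
    sub_inv_eq_div hq]
  rcases h.generic with h0 | ⟨hνq, hd⟩
  · simp only [h0, zero_mul, mul_zero, smul_zero, add_zero, sub_zero]
    generalize q ^ ((i : ℕ) + 1) = x at *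
    match_scalars <;> field_simp <;> ring
  · have hdi : q * ν - (q ^ ((i : ℕ) + 1)) ^ 2 ≠ 0 := by
      intro h1
      apply hd i
      apply mul_left_cancel₀ hq
      rw [sub_eq_zero.mp h1]; ring
    have hdj : ν - q * (q ^ ((i : ℕ) + 1)) ^ 2 ≠ 0 := by
      intro h1
      apply hd j
      rw [sub_eq_zero.mp h1, ← hij]; ring
    generalize q ^ ((i : ℕ) + 1) = x at *
    have hdi' : 1 - ν⁻¹ * q⁻¹ * x ^ 2 = (q * ν - x ^ 2) / (ν * q) := by field_simp
    have hdj' : 1 - ν⁻¹ * q⁻¹ * (q * x) ^ 2 = (ν - q * x ^ 2) / ν := by field_simp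
    rw [hdi', hdj']
    match_scalars <;> field_simp <;> ring

end IsBMWSystem

/-! ### The multiplicative shuffle element of a BMW system -/

/-- The product `σ_1(q) σ_2(q²) ⋯ σ_n(qⁿ)` of baxterized elements. -/
def shuffle {k A : Type*} [Field k] [Ring A] [Algebra k A] (q ν : k) {n : ℕ} (σ κ : Fin n → A) :
    A :=
  (List.ofFn fun i => baxterize q ν (σ i) (κ i) (q ^ ((i : ℕ) + 1))).prod

lemma List.prod_ofFn_mul_of_eigen {k A : Type*} [Field k] [Ring A] [Algebra k A] {n : ℕ}
    (b : Fin n → A) (e : Fin n → k) {X : A} (h : ∀ i, b i * X = e i • X) :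
    (List.ofFn b).prod * X = (∏ i, e i) • X := by
  induction n with
  | zero => simp
  | succ n ih =>
    rw [List.ofFn_succ, List.prod_cons, mul_assoc, ih _ (fun i => e i.succ) fun i => h i.succ,
      mul_smul_comm, h, smul_smul, Fin.prod_univ_succ, mul_comm]

lemma List.prod_ofFn_eq_take_mul_drop {A : Type*} [Monoid A] {n : ℕ} (b : Fin n → A) (i : Fin n) :
    (List.ofFn b).prod =
      ((List.ofFn b).take i).prod * (b i * ((List.ofFn b).drop (i + 1)).prod) := by
  rw [← List.prod_take_mul_prod_drop (List.ofFn b) i,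
    List.drop_eq_getElem_cons (l := List.ofFn b) (i := i) (by simp), List.prod_cons]
  simp

lemma List.commute_prod_take_ofFn {A : Type*} [Monoid A] {n : ℕ} {b : Fin n → A} {a : A} {m : ℕ}
    (h : ∀ i : Fin n, (i : ℕ) < m → Commute a (b i)) : Commute a ((List.ofFn b).take m).prod := by
  refine Commute.list_prod_right _ _ fun x hx => ?_
  obtain ⟨i, hi, rfl⟩ := List.mem_take_iff_getElem.mp hx
  rw [List.length_ofFn, lt_min_iff] at hi
  simpa using h ⟨i, hi.2⟩ hi.1

lemma List.commute_prod_drop_ofFn {A : Type*} [Monoid A] {n : ℕ} {b : Fin n → A} {a : A} {m : ℕ}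
    (h : ∀ i : Fin n, m ≤ (i : ℕ) → Commute a (b i)) : Commute a ((List.ofFn b).drop m).prod := by
  refine Commute.list_prod_right _ _ fun x hx => ?_
  obtain ⟨i, hi, rfl⟩ := List.mem_drop_iff_getElem.mp hx
  rw [List.length_ofFn] at hi
  simpa [add_comm] using h ⟨_, hi⟩ (Nat.le_add_left _ _)

lemma qNum_one {k : Type*} [Field k] {q : k} (hq : q ≠ 0) (hq2 : q ^ 2 ≠ 1) : qNum q 1 = 1 := by
  rw [qNum, pow_one, div_self (sub_inv_ne_zero_of_sq_ne_one hq hq2)]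

lemma prod_qNum_add_two {k : Type*} [Field k] {q : k} (hq : q ≠ 0) (hq2 : q ^ 2 ≠ 1) (n : ℕ) :
    ∏ i : Fin n, qNum q ((i : ℕ) + 1 + 1) = qFact q (n + 1) := by
  rw [Fin.prod_univ_eq_prod_range (fun i => qNum q (i + 1 + 1)) n, qFact,
    ← Finset.prod_Ioc_mul_eq_prod_Icc (by omega), qNum_one hq hq2, mul_one]
  rw [← Finset.Ico_add_one_add_one_eq_Ioc, Finset.prod_Ico_eq_prod_range]
  refine Finset.prod_congr (by simp) fun i _ => ?_
  congr 1; omega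

namespace IsBMWSystem

variable {k A : Type*} [Field k] [Ring A] [Algebra k A] {q ν : k} {n : ℕ} {σ τ κ : Fin n → A}

lemma gen_zero_mul_shuffle (h : IsBMWSystem q ν σ τ κ) (i : Fin n) (hi : (i : ℕ) = 0) :
    σ i * shuffle q ν σ κ = q • shuffle q ν σ κ := by
  have h1 := h.gen_mul_baxterize i
  rw [shuffle, List.prod_ofFn_eq_take_mul_drop _ i, hi, List.take_zero, List.prod_nil, one_mul,
    zero_add, pow_one, ← mul_assoc, h1, smul_mul_assoc]

lemma gen_succ_mul_shuffle_mul (h : IsBMWSystem q ν σ τ κ) (i j : Fin n) (hij : (i : ℕ) + 1 = j)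
    {X : A} (hX : σ i * X = q • X) :
    σ j * (shuffle q ν σ κ * X) = q • (shuffle q ν σ κ * X) := by
  set b : Fin n → A := fun i => baxterize q ν (σ i) (κ i) (q ^ ((i : ℕ) + 1)) with hb
  have hP : Commute (σ j) ((List.ofFn b).take i).prod :=
    List.commute_prod_take_ofFn fun m hm => h.baxterize_commute _ (Or.inr (by omega))
  have hQ : Commute (σ i) ((List.ofFn b).drop (j + 1)).prod :=
    List.commute_prod_drop_ofFn fun m hm => h.baxterize_commute _ (Or.inl (by omega))
  have hT : shuffle q ν σ κ = ((List.ofFn b).take i).prod *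
      (b i * (b j * ((List.ofFn b).drop (j + 1)).prod)) := by
    rw [shuffle, List.prod_ofFn_eq_take_mul_drop _ i, hij,
      List.drop_eq_getElem_cons (l := List.ofFn b) (i := j) (by simp), List.prod_cons]
    simp [hb, hij]
  have hQX : σ i * (((List.ofFn b).drop (j + 1)).prod * X) =
      q • (((List.ofFn b).drop (j + 1)).prod * X) := by
    rw [← mul_assoc, hQ.eq, mul_assoc, hX, mul_smul_comm]
  have key := h.gen_mul_baxterize_mul_baxterize i j hij hQX
  rw [hT]
  generalize ((List.ofFn b).take i).prod = P at *
  generalize ((List.ofFn b).drop (j + 1)).prod = Q at *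
  simp only [mul_assoc]
  rw [← mul_assoc, hP.eq, mul_assoc, ← mul_smul_comm]
  exact congrArg (P * ·) key

/-- Each multiplication by the shuffle element produces one more `q`-eigenvector condition. -/
lemma gen_mul_shuffle_pow (h : IsBMWSystem q ν σ τ κ) (m : ℕ) (i : Fin n) (hi : (i : ℕ) < m) :
    σ i * shuffle q ν σ κ ^ m = q • shuffle q ν σ κ ^ m := by
  induction m generalizing i with
  | zero => omega
  | succ m ih =>
    rw [pow_succ']
    rcases Nat.eq_zero_or_pos (i : ℕ) with h0 | h0
    · rw [← mul_assoc, h.gen_zero_mul_shuffle i h0, smul_mul_assoc]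
    · exact h.gen_succ_mul_shuffle_mul ⟨i - 1, by omega⟩ i (by simp; omega)
        (ih ⟨i - 1, by omega⟩ (by simp; omega))

lemma shuffle_mul_of_eigen (h : IsBMWSystem q ν σ τ κ) {X : A} (hX : ∀ i, σ i * X = q • X) :
    shuffle q ν σ κ * X = qFact q (n + 1) • X := by
  rw [← prod_qNum_add_two h.q_ne h.q_sq_ne]
  exact List.prod_ofFn_mul_of_eigen _ _ fun i => h.baxterize_mul_of_eigen i _ (hX i)

lemma shuffle_pow_succ (h : IsBMWSystem q ν σ τ κ) :
    shuffle q ν σ κ ^ (n + 1) = qFact q (n + 1) • shuffle q ν σ κ ^ n := by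
  rw [pow_succ', h.shuffle_mul_of_eigen fun i => h.gen_mul_shuffle_pow n i i.2]

lemma shuffle_pow_mul_sub (h : IsBMWSystem q ν σ τ κ) :
    shuffle q ν σ κ ^ n * (shuffle q ν σ κ - algebraMap k A (qFact q (n + 1))) = 0 := by
  rw [mul_sub, ← pow_succ, h.shuffle_pow_succ, ← Algebra.commutes, ← Algebra.smul_def, sub_self]

lemma map_kappa_of_character (h : IsBMWSystem q ν σ τ κ) (χ : A →ₐ[k] k) (hχ : ∀ i, χ (σ i) = q)
    (i : Fin n) : χ (κ i) = 0 := by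
  have h1 : χ (τ i) = q⁻¹ := by
    have := congrArg χ (h.gen_inv i)
    rw [map_mul, hχ, map_one] at this
    exact eq_inv_of_mul_eq_one_right this
  rw [h.kappa_eq, map_sub, map_smul, map_sub, hχ, h1, map_one, smul_eq_mul,
    inv_mul_cancel₀ h.lam_ne, sub_self]

lemma map_shuffle_of_character (h : IsBMWSystem q ν σ τ κ) (χ : A →ₐ[k] k)
    (hχ : ∀ i, χ (σ i) = q) : χ (shuffle q ν σ κ) = qFact q (n + 1) := by
  have hq := h.q_ne
  have hl := sub_ne_zero.mpr h.q_sq_ne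
  rw [shuffle, map_list_prod, List.map_ofFn, List.prod_ofFn, ← prod_qNum_add_two hq h.q_sq_ne]
  refine Finset.prod_congr rfl fun i _ => ?_
  have hm : q ^ ((i : ℕ) + 1) ≠ 0 := pow_ne_zero _ hq
  simp only [Function.comp, baxterize, map_smul, map_add, map_one, hχ,
    h.map_kappa_of_character χ hχ, qNum, smul_eq_mul, mul_zero, add_zero, sub_inv_eq_div hq,
    pow_succ q ((i : ℕ) + 1)]
  generalize q ^ ((i : ℕ) + 1) = x at *
  field_simp
  ring

/-- A left symmetrizer: the normalized `n`-th power of the shuffle element. -/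
lemma exists_left_symmetrizer (h : IsBMWSystem q ν σ τ κ) (χ : A →ₐ[k] k)
    (hχ : ∀ i, χ (σ i) = q) (hc : qFact q (n + 1) ≠ 0) :
    ∃ S : A, χ S = 1 ∧ (∀ i, σ i * S = q • S) ∧
      shuffle q ν σ κ ^ n = qFact q (n + 1) ^ n • S := by
  refine ⟨(qFact q (n + 1) ^ n)⁻¹ • shuffle q ν σ κ ^ n, ?_, fun i => ?_, ?_⟩
  · rw [map_smul, map_pow, h.map_shuffle_of_character χ hχ, smul_eq_mul,
      inv_mul_cancel₀ (pow_ne_zero _ hc)]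
  · rw [mul_smul_comm, h.gen_mul_shuffle_pow n i i.2, smul_comm]
  · rw [smul_smul, mul_inv_cancel₀ (pow_ne_zero _ hc), one_smul]

/-- The algebra acts through the character `χ` on common `q`-eigenvectors of the generators. -/
lemma mul_of_eigen (h : IsBMWSystem q ν σ τ κ) (χ : A →ₐ[k] k) (hχ : ∀ i, χ (σ i) = q)
    (hgen : Algebra.adjoin k (Set.range σ ∪ Set.range τ) = ⊤) {S : A}
    (hS : ∀ i, σ i * S = q • S) (a : A) : a * S = χ a • S := by
  have ha : a ∈ Algebra.adjoin k (Set.range σ ∪ Set.range τ) := hgen ▸ Algebra.mem_top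
  induction ha using Algebra.adjoin_induction with
  | mem x hx =>
    rcases hx with ⟨i, rfl⟩ | ⟨i, rfl⟩
    · rw [hS, hχ]
    · have h1 : τ i * S = q⁻¹ • S := by
        have := congrArg (fun a => q⁻¹ • (τ i * a)) (hS i)
        simpa [← mul_assoc, h.inv_gen, smul_smul, h.q_ne] using this.symm
      rw [h.inv_eq, map_sub, map_smul, map_sub, h.map_kappa_of_character χ hχ, hχ, map_one,
        ← h.inv_eq, h1]
      simp
  | algebraMap r => rw [AlgHom.commutes, Algebra.algebraMap_self_apply, Algebra.smul_def]
  | add x y _ _ hx hy => rw [add_mul, hx, hy, map_add, add_smul]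
  | mul x y _ _ hx hy => rw [mul_assoc, hy, mul_smul_comm, hx, map_mul, smul_smul, mul_comm]

end IsBMWSystem

/-! ### Elements with a power proportional to a symmetrizer -/

/-- A nilpotent polynomial in a semisimple operator vanishes; no finiteness is assumed. -/
lemma Module.End.IsSemisimple.aeval_eq_zero_of_pow {k V : Type*} [Field k] [AddCommGroup V]
    [Module k V] {f : Module.End k V} (hf : f.IsSemisimple) {p : k[X]} {m : ℕ}
    (h : aeval f (p ^ m) = 0) : aeval f p = 0 := by
  rw [← RingHom.mem_ker, ← Module.AEval.annihilator_eq_ker_aeval (M := V)] at h ⊢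
  exact hf.annihilator_isRadical _ _ ⟨m, h⟩

lemma aeval_leftMul {k A : Type*} [Field k] [Ring A] [Algebra k A] (u : A) (p : k[X]) :
    aeval (leftMul k u) p = leftMul k (aeval u p) :=
  aeval_algHom_apply (Algebra.lmul k A) u p

lemma leftMul_eq_zero_iff {k A : Type*} [Field k] [Ring A] [Algebra k A] {u : A} :
    leftMul k u = 0 ↔ u = 0 :=
  map_eq_zero_iff (Algebra.lmul k A) Algebra.lmul_injective

lemma IsSemisimpleElt.aeval_eq_zero_of_pow {k A : Type*} [Field k] [Ring A] [Algebra k A] {u : A}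
    (hu : IsSemisimpleElt k u) {p : k[X]} {m : ℕ} (h : aeval u p ^ m = 0) : aeval u p = 0 := by
  rw [← leftMul_eq_zero_iff (k := k), ← aeval_leftMul]
  refine Module.End.IsSemisimple.aeval_eq_zero_of_pow hu (m := m) ?_
  rw [aeval_leftMul, map_pow, h, leftMul_eq_zero_iff]

lemma isSemisimpleElt_of_mul_sub_eq_zero {k A : Type*} [Field k] [Ring A] [Algebra k A] {u : A}
    {c : k} (hc : c ≠ 0) (hu : u * (u - algebraMap k A c) = 0) : IsSemisimpleElt k u := by
  refine Module.End.isSemisimple_of_squarefree_aeval_eq_zero (p := X * (X - C c)) ?_ ?_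
  · have h0 : IsCoprime (X : k[X]) (X - C c) := by
      simpa using isCoprime_X_sub_C_of_isUnit_sub (R := k) (a := 0) (b := c) (by simpa using hc)
    exact squarefree_mul_iff.mpr ⟨h0.isRelPrime, irreducible_X.squarefree,
      (irreducible_X_sub_C c).squarefree⟩
  · rw [aeval_leftMul, leftMul_eq_zero_iff]
    simpa using hu

lemma minpoly_eq_X_pow_mul_X_sub_C {k A : Type*} [Field k] [Ring A] [Algebra k A] {T : A} {c : k}
    {n : ℕ} (h : T ^ n * (T - algebraMap k A c) = 0) (hT : T ^ n ≠ 0)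
    (h' : 0 < n → T ^ (n - 1) * (T - algebraMap k A c) ≠ 0) :
    minpoly k T = X ^ n * (X - C c) := by
  have hmon : (X ^ n * (X - C c) : k[X]).Monic := (monic_X_pow n).mul (monic_X_sub_C c)
  have hp : aeval T (X ^ n * (X - C c) : k[X]) = 0 := by simpa using h
  have hint : IsIntegral k T := ⟨_, hmon, hp⟩
  -- a non-unit cofactor `r` of `minpoly k T` would be divisible by `X` or by `X - C c`, and then
  -- `T` would be killed by a smaller divisor of `X ^ n * (X - C c)`
  obtain ⟨r, hr⟩ := minpoly.dvd k T hp
  by_cases hu : IsUnit r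
  · exact eq_of_monic_of_associated (minpoly.monic hint) hmon ⟨hu.unit, hr.symm⟩
  exfalso
  have hr0 : r ≠ 0 := by rintro rfl; exact hmon.ne_zero (by simpa using hr)
  obtain ⟨g, hg, s, rfl⟩ := WfDvdMonoid.exists_irreducible_factor hu hr0
  rcases hg.prime.dvd_or_dvd (show g ∣ X ^ n * (X - C c) from hr ▸ ⟨minpoly k T * s, by ring⟩)
    with h1 | h1
  · have hn : 0 < n := Nat.pos_of_ne_zero fun h0 => hg.not_isUnit (isUnit_of_dvd_one (by
      simpa [h0] using h1))
    obtain ⟨t, ht⟩ := (hg.associated_of_dvd irreducible_X (hg.prime.dvd_of_dvd_pow h1)).symm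
    refine h' hn ?_
    have h2 : (X ^ (n - 1) * (X - C c) : k[X]) = minpoly k T * (t * s) := by
      apply mul_left_cancel₀ (X_ne_zero (R := k))
      rw [← mul_assoc, ← pow_succ', Nat.sub_add_cancel hn, hr, ← ht]; ring
    simpa [minpoly.aeval] using congrArg (aeval T) h2
  · obtain ⟨t, ht⟩ := (hg.associated_of_dvd (irreducible_X_sub_C c) h1).symm
    refine hT ?_
    have h2 : (X ^ n : k[X]) = minpoly k T * (t * s) := by
      apply mul_right_cancel₀ (X_sub_C_ne_zero (R := k) c)
      rw [hr, ← ht]; ring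
    simpa [minpoly.aeval] using congrArg (aeval T) h2

/-- If `T` were semisimple, then `T (T - c)`, being nilpotent, would vanish. -/
lemma not_isSemisimpleElt {k A : Type*} [Field k] [Ring A] [Algebra k A] {T : A} {c : k}
    {n : ℕ} (hn : 1 < n) (h : T ^ n * (T - algebraMap k A c) = 0)
    (h' : T ^ (n - 1) * (T - algebraMap k A c) ≠ 0) : ¬ IsSemisimpleElt k T := by
  intro hs
  have hcomm : Commute T (T - algebraMap k A c) :=
    (Commute.refl T).sub_right (Algebra.commutes c T).symm
  have h1 : aeval T (X * (X - C c) : k[X]) = 0 := by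
    refine hs.aeval_eq_zero_of_pow (m := n) ?_
    simp only [map_mul, map_sub, aeval_X, aeval_C]
    obtain ⟨m, rfl⟩ := Nat.exists_eq_add_of_lt hn
    rw [hcomm.mul_pow, pow_succ' (T - _), ← mul_assoc, h, zero_mul]
  simp only [map_mul, map_sub, aeval_X, aeval_C] at h1
  refine h' ?_
  obtain ⟨m, rfl⟩ := Nat.exists_eq_add_of_lt hn
  rw [show 1 + m + 1 - 1 = m + 1 by omega, pow_succ, mul_assoc, h1, mul_zero]

section Symmetrizer

variable {k A : Type*} [Field k] [Ring A] [Algebra k A] {χ : A →ₐ[k] k} {T S : A} {c : k} {n : ℕ}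

lemma sub_smul_pow_eq_zero (hl : ∀ a, a * S = χ a • S) (hr : ∀ a, S * a = χ a • S)
    (hS : χ S = 1) (hT : χ T = c) (hTn : T ^ n = c ^ n • S) : (T - c • S) ^ (n + 1) = 0 := by
  have hSS : S * S = S := by rw [hl, hS, one_smul]
  have h1 : T - c • S = T * (1 - S) := by rw [mul_sub, mul_one, hl, hT]
  have h2 : Commute T (1 - S) :=
    (Commute.one_right _).sub_right (show T * S = S * T by rw [hl, hr])
  rw [h1, h2.mul_pow, pow_succ, hTn, pow_succ', smul_mul_assoc, smul_mul_assoc, hr T]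
  simp only [smul_mul_assoc, ← mul_assoc, mul_sub, mul_one, hSS, sub_self, zero_mul, smul_zero]

/-- The semisimple part is unique over an arbitrary field: on `S A` both operators act by the
scalar `c`, and on `(1 - S) A` a semisimple part of `T` is nilpotent, hence zero. -/
lemma isSemisimplePart_iff (hl : ∀ a, a * S = χ a • S) (hr : ∀ a, S * a = χ a • S)
    (hS : χ S = 1) (hT : χ T = c) (hTn : T ^ n = c ^ n • S) (hc : c ≠ 0) (s : A) :
    IsSemisimplePart k T s ↔ s = c • S := by
  have hSS : S * S = S := by rw [hl, hS, one_smul]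
  constructor
  · rintro ⟨hss, hsT, hnil⟩
    have hχs : χ s = c := by
      have := hnil.map χ
      rw [map_sub, hT] at this
      exact (sub_eq_zero.mp this.eq_zero).symm
    set N := s - c • S with hN
    have hsS : Commute s S := show s * S = S * s by rw [hl, hr]
    have hTS : Commute T S := show T * S = S * T by rw [hl, hr]
    have hNS : N * S = 0 := by rw [hN, sub_mul, hl, hχs, smul_mul_assoc, hSS, sub_self]
    have hSN : S * N = 0 := by rw [hN, mul_sub, hr, hχs, mul_smul_comm, hSS, sub_self]
    have hNnil : IsNilpotent N := by
      have h1 : N = (T - c • S) - (T - s) := by rw [hN]; abel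
      rw [h1]
      refine Commute.isNilpotent_sub ?_ ⟨_, sub_smul_pow_eq_zero hl hr hS hT hTn⟩ hnil
      exact ((Commute.refl T).sub_right hsT.symm).sub_left
        ((hTS.symm.sub_right hsS.symm).smul_left c)
    have hs : s = c • S + N := by rw [hN]; abel
    have hprod : s * (s - algebraMap k A c) = N * (N - algebraMap k A c) := by
      simp only [hs, Algebra.algebraMap_eq_smul_one, mul_sub, mul_add, add_mul, smul_mul_assoc,
        mul_smul_comm, hSS, hSN, hNS, mul_one]
      module
    have hNc : Commute N (N - algebraMap k A c) :=
      (Commute.refl N).sub_right (Algebra.commutes c N).symm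
    have hzero : s * (s - algebraMap k A c) = 0 := by
      obtain ⟨m, hm⟩ := hNnil
      have := hss.aeval_eq_zero_of_pow (p := X * (X - C c)) (m := m) (by
        simp only [map_mul, map_sub, aeval_X, aeval_C]
        rw [hprod, hNc.mul_pow, hm, zero_mul])
      simpa using this
    -- `N` is nilpotent and `c ≠ 0`, so the factor `N - c` of `N (N - c) = 0` is invertible
    have hunit : IsUnit (N - algebraMap k A c) := by
      have hu : IsUnit (-algebraMap k A c) := ((IsUnit.mk0 c hc).map (algebraMap k A)).neg
      have := IsNilpotent.isUnit_add_left_of_commute hNnil hu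
        (Commute.neg_right (Algebra.commutes c N).symm)
      rwa [neg_add_eq_sub] at this
    have hN0 : N = 0 := by
      rw [hprod] at hzero
      exact hunit.mul_left_eq_zero.mp hzero
    rw [hs, hN0, add_zero]
  · rintro rfl
    refine ⟨isSemisimpleElt_of_mul_sub_eq_zero hc ?_, ?_,
      ⟨_, sub_smul_pow_eq_zero hl hr hS hT hTn⟩⟩
    · rw [mul_sub, smul_mul_smul_comm, hSS, ← Algebra.commutes, ← Algebra.smul_def, smul_smul,
        sub_self]
    · exact Commute.smul_left (show S * T = T * S by rw [hl, hr]) c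

/-- `T` is nilpotent on `(1 - S) A`, which therefore meets the generalized eigenspace for `c ≠ 0`
trivially. -/
lemma maxGenEigenspace_leftMul (hl : ∀ a, a * S = χ a • S) (hr : ∀ a, S * a = χ a • S)
    (hS : χ S = 1) (hT : χ T = c) (hTn : T ^ n = c ^ n • S) (hc : c ≠ 0) :
    (leftMul k T).maxGenEigenspace c = k ∙ S := by
  have hSS : S * S = S := by rw [hl, hS, one_smul]
  apply le_antisymm
  · intro x hx
    have hy : x - S * x ∈ (leftMul k T).maxGenEigenspace c := by
      refine sub_mem hx ?_
      rw [hr, Module.End.mem_maxGenEigenspace]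
      exact ⟨1, by simp [hl, hT]⟩
    have hy0 : x - S * x ∈ (leftMul k T).maxGenEigenspace 0 := by
      rw [Module.End.mem_maxGenEigenspace]
      refine ⟨n, ?_⟩
      rw [zero_smul, sub_zero, LinearMap.pow_mulLeft, LinearMap.mulLeft_apply, hTn, smul_mul_assoc,
        mul_sub, ← mul_assoc, hSS, sub_self, smul_zero]
    have := ((leftMul k T).disjoint_genEigenspace hc ⊤ ⊤).le_bot ⟨hy, hy0⟩
    rw [Submodule.mem_bot, sub_eq_zero, hr] at this
    rw [this]
    exact Submodule.smul_mem _ _ (Submodule.mem_span_singleton_self S)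
  · rw [Submodule.span_singleton_le_iff_mem, Module.End.mem_maxGenEigenspace]
    exact ⟨1, by simp [hl, hT]⟩

lemma isSimpleEigenvalue_of_symmetrizer (hl : ∀ a, a * S = χ a • S) (hr : ∀ a, S * a = χ a • S)
    (hS : χ S = 1) (hT : χ T = c) (hTn : T ^ n = c ^ n • S) (hc : c ≠ 0) :
    IsSimpleEigenvalue k T c := by
  rw [IsSimpleEigenvalue, maxGenEigenspace_leftMul hl hr hS hT hTn hc]
  refine finrank_span_singleton ?_
  rintro rfl
  simp at hS

end Symmetrizer

namespace IsBMWSystem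

variable {k A : Type*} [Field k] [Ring A] [Algebra k A] {q ν : k} {n : ℕ} {σ τ κ : Fin n → A}

/-- The left and the right normalized `n`-th powers of the shuffle elements coincide and give a
two-sided symmetrizer on which the algebra acts through the character `χ`. -/
lemma exists_symmetrizer (h : IsBMWSystem q ν σ τ κ) (χ : A →ₐ[k] k) (hχ : ∀ i, χ (σ i) = q)
    (hgen : Algebra.adjoin k (Set.range σ ∪ Set.range τ) = ⊤) (hc : qFact q (n + 1) ≠ 0) :
    ∃ S : A, (∀ a, a * S = χ a • S) ∧ (∀ a, S * a = χ a • S) ∧ χ S = 1 ∧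
      shuffle q ν σ κ ^ n = qFact q (n + 1) ^ n • S := by
  obtain ⟨S, hS, hσS, hTS⟩ := h.exists_left_symmetrizer χ hχ hc
  let χ' : Aᵐᵒᵖ →ₐ[k] k := χ.fromOpposite fun _ _ => mul_comm _ _
  obtain ⟨S', hS', hσS', -⟩ := h.op.exists_left_symmetrizer χ' hχ hc
  have hl := h.mul_of_eigen χ hχ hgen hσS
  have hgen' : Algebra.adjoin k (Set.range (fun i => MulOpposite.op (σ i)) ∪
      Set.range (fun i => MulOpposite.op (τ i))) = ⊤ := by
    have h1 := congrArg Subalgebra.op hgen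
    rw [Subalgebra.op_adjoin, Subalgebra.op_top] at h1
    rw [← h1]
    congr 1
    ext x
    simp [← MulOpposite.op_inj (α := A)]
  have hr : ∀ a, S'.unop * a = χ a • S'.unop := fun a =>
    congrArg MulOpposite.unop (h.op.mul_of_eigen χ' hχ hgen' hσS' (MulOpposite.op a))
  have hSS : S'.unop = S := by
    have h1 := hl S'.unop
    rw [hr, hS, one_smul] at h1
    rw [h1, show χ S'.unop = 1 from hS', one_smul]
  rw [hSS] at hr
  exact ⟨S, hl, hr, hS, hTS⟩

lemma eq_of_isSymmetrizer (h : IsBMWSystem q ν σ τ κ) (χ : A →ₐ[k] k) (hχ : ∀ i, χ (σ i) = q)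
    (hgen : Algebra.adjoin k (Set.range σ ∪ Set.range τ) = ⊤) {S S' : A}
    (hr : ∀ a, S * a = χ a • S) (hS : χ S = 1) (hS' : IsSymmetrizer q σ S') : S' = S := by
  obtain ⟨h0, h1, h2⟩ := hS'
  have hl' := h.mul_of_eigen χ hχ hgen fun i => (h1 i).1
  have h3 : S' = χ S' • S := by rw [← hr, hl', hS, one_smul]
  have h4 : χ S' = 1 := by
    have h5 : χ S' * χ S' = χ S' * 1 := by rw [← map_mul, h2, mul_one]
    refine mul_left_cancel₀ (fun h6 => h0 ?_) h5
    rw [h3, h6, zero_smul]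
  rw [h3, h4, one_smul]

/-- All assertions about the shuffle element, given the character `σ_i ↦ q` and the
non-vanishing that bounds the degree of the minimal polynomial from below. -/
theorem shuffle_spectral (h : IsBMWSystem q ν σ τ κ) (χ : A →ₐ[k] k) (hχ : ∀ i, χ (σ i) = q)
    (hgen : Algebra.adjoin k (Set.range σ ∪ Set.range τ) = ⊤)
    (hne : qFact q (n + 1) ≠ 0 → 0 < n → shuffle q ν σ κ ^ (n - 1) *
      (shuffle q ν σ κ - algebraMap k A (qFact q (n + 1))) ≠ 0) :
    shuffle q ν σ κ ^ n * (shuffle q ν σ κ - algebraMap k A (qFact q (n + 1))) = 0 ∧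
      (qFact q (n + 1) ≠ 0 →
        minpoly k (shuffle q ν σ κ) = X ^ n * (X - C (qFact q (n + 1))) ∧
        (1 < n → ¬ IsSemisimpleElt k (shuffle q ν σ κ)) ∧
        (∃! S : A, IsSymmetrizer q σ S) ∧
        (∀ S : A, IsSymmetrizer q σ S → ∀ s : A,
          IsSemisimplePart k (shuffle q ν σ κ) s ↔ s = qFact q (n + 1) • S) ∧
        IsSimpleEigenvalue k (shuffle q ν σ κ) (qFact q (n + 1))) := by
  refine ⟨h.shuffle_pow_mul_sub, fun hc => ?_⟩
  have hχT := h.map_shuffle_of_character χ hχ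
  obtain ⟨S, hl, hr, hS, hTn⟩ := h.exists_symmetrizer χ hχ hgen hc
  refine ⟨minpoly_eq_X_pow_mul_X_sub_C h.shuffle_pow_mul_sub ?_ (hne hc),
    fun hn => not_isSemisimpleElt hn h.shuffle_pow_mul_sub (hne hc (by omega)), ⟨S, ?_, ?_⟩, ?_,
    isSimpleEigenvalue_of_symmetrizer hl hr hS hχT hTn hc⟩
  · intro h0
    have := congrArg χ h0
    rw [map_pow, hχT, map_zero] at this
    exact pow_ne_zero _ hc this
  · refine ⟨?_, fun i => ⟨?_, ?_⟩, ?_⟩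
    · rintro rfl; simp at hS
    · rw [hl, hχ]
    · rw [hr, hχ]
    · rw [hl, hS, one_smul]
  · exact fun S' hS' => h.eq_of_isSymmetrizer χ hχ hgen hr hS hS'
  · intro S' hS' s
    rw [h.eq_of_isSymmetrizer χ hχ hgen hr hS hS']
    exact isSemisimplePart_iff hl hr hS hχT hTn hc s

end IsBMWSystem

/-! ### Universal properties of the Hecke and BMW algebras -/

/-- Units satisfying the Artin relations define a representation of the group ring of the braid
group. -/
noncomputable def braidRingLift {k A : Type*} [Field k] [Ring A] [Algebra k A] {M : ℕ}
    (u : Fin M → Aˣ)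
    (hbraid : ∀ i j : Fin M, (i : ℕ) + 1 = j → u i * u j * u i = u j * u i * u j)
    (hcomm : ∀ i j : Fin M, (i : ℕ) + 1 < j → u i * u j = u j * u i) : BraidRing k M →ₐ[k] A :=
  MonoidAlgebra.lift k A (BraidGroup M) ((Units.coeHom A).comp (PresentedGroup.toGroup (f := u) (by
    rintro r (⟨i, j, hij, rfl⟩ | ⟨i, j, hij, rfl⟩)
    · simp only [map_mul, map_inv, FreeGroup.lift_apply_of, hbraid i j hij]
      exact mul_inv_cancel _
    · simp only [map_mul, map_inv, FreeGroup.lift_apply_of, hcomm i j hij]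
      exact mul_inv_cancel _)))

section Braid

variable {k A : Type*} [Field k] [Ring A] [Algebra k A] {M : ℕ} {u : Fin M → Aˣ}
  {hbraid : ∀ i j : Fin M, (i : ℕ) + 1 = j → u i * u j * u i = u j * u i * u j}
  {hcomm : ∀ i j : Fin M, (i : ℕ) + 1 < j → u i * u j = u j * u i}

lemma braidRingLift_gen (i : Fin M) :
    braidRingLift (k := k) u hbraid hcomm (toBraidRing k (braidGen i)) = u i := by
  rw [braidRingLift, toBraidRing, MonoidAlgebra.lift_of, MonoidHom.comp_apply, braidGen,
    PresentedGroup.toGroup.of]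
  rfl

end Braid

lemma toBraidRing_mul (k : Type*) [Field k] {M : ℕ} (a b : BraidGroup M) :
    toBraidRing k (a * b) = toBraidRing k a * toBraidRing k b := map_mul _ a b

lemma toBraidRing_one (k : Type*) [Field k] {M : ℕ} :
    toBraidRing k (1 : BraidGroup M) = 1 := map_one (MonoidAlgebra.of k (BraidGroup M))

lemma braidGen_braid {M : ℕ} (i j : Fin M) (hij : (i : ℕ) + 1 = j) :
    braidGen i * braidGen j * braidGen i = braidGen j * braidGen i * braidGen j :=
  PresentedGroup.mk_eq_mk_of_mul_inv_mem (Or.inl ⟨i, j, hij, rfl⟩)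

lemma braidGen_comm {M : ℕ} (i j : Fin M) (hij : (i : ℕ) + 1 < j) :
    braidGen i * braidGen j = braidGen j * braidGen i :=
  PresentedGroup.mk_eq_mk_of_mul_inv_mem (Or.inr ⟨i, j, hij, rfl⟩)

/-- A quotient of the braid group ring is generated by the generators and their inverses. -/
lemma adjoin_braidGen_eq_top {k A : Type*} [Field k] [Ring A] [Algebra k A] {M : ℕ}
    (f : BraidRing k M →ₐ[k] A) (hf : Function.Surjective f) :
    Algebra.adjoin k (Set.range (fun i => f (toBraidRing k (braidGen i))) ∪
      Set.range (fun i => f (toBraidRing k (braidGen i)⁻¹))) = ⊤ := by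
  set B := Algebra.adjoin k (Set.range (fun i => f (toBraidRing k (braidGen i))) ∪
      Set.range (fun i => f (toBraidRing k (braidGen i)⁻¹))) with hB
  have hgrp : ∀ g : BraidGroup M,
      f (toBraidRing k g) ∈ B ∧ f (toBraidRing k g⁻¹) ∈ B := by
    intro g
    have hg : g ∈ Subgroup.closure (Set.range (PresentedGroup.of (rels := artinRels M))) := by
      rw [PresentedGroup.closure_range_of]; trivial
    induction hg using Subgroup.closure_induction with
    | mem x hx =>
      obtain ⟨i, rfl⟩ := hx
      exact ⟨Algebra.subset_adjoin (Or.inl ⟨i, rfl⟩), Algebra.subset_adjoin (Or.inr ⟨i, rfl⟩)⟩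
    | one => rw [inv_one, toBraidRing_one, map_one]; exact ⟨one_mem _, one_mem _⟩
    | mul x y _ _ hx hy =>
      rw [mul_inv_rev, toBraidRing_mul, toBraidRing_mul, map_mul, map_mul]
      exact ⟨mul_mem hx.1 hy.1, mul_mem hy.2 hx.2⟩
    | inv x _ hx => rw [inv_inv]; exact hx.symm
  rw [eq_top_iff]
  rintro a -
  obtain ⟨x, rfl⟩ := hf a
  induction x using MonoidAlgebra.induction_on with
  | of g => exact (hgrp g).1
  | add x y hx hy => rw [map_add]; exact add_mem hx hy
  | smul r x hx => rw [map_smul]; exact B.smul_mem hx r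

section Hecke

variable {k : Type*} [Field k] {q : k} {M : ℕ}

/-- The inverse generator of the Hecke algebra. -/
noncomputable abbrev heckeGenInv (q : k) (i : Fin M) : HeckeAlg q M := heckeOf q (braidGen i)⁻¹

lemma heckeOf_mul (a b : BraidGroup M) : heckeOf q (a * b) = heckeOf q a * heckeOf q b := by
  rw [heckeOf, toBraidRing_mul, map_mul]; rfl

lemma heckeOf_one : heckeOf q (1 : BraidGroup M) = 1 := by
  rw [heckeOf, toBraidRing_one, map_one]

lemma heckeGen_mul_inv (i : Fin M) : heckeGen q i * heckeGenInv q i = 1 := by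
  rw [heckeGen, heckeGenInv, ← heckeOf_mul, mul_inv_cancel, heckeOf_one]

lemma heckeGenInv_mul (i : Fin M) : heckeGenInv q i * heckeGen q i = 1 := by
  rw [heckeGen, heckeGenInv, ← heckeOf_mul, inv_mul_cancel, heckeOf_one]

lemma heckeGen_mul_self (i : Fin M) :
    heckeGen q i * heckeGen q i = (q - q⁻¹) • heckeGen q i + 1 := by
  have := RingQuot.mkAlgHom_rel k (HeckeRel.quad (q := q) i)
  simpa only [map_mul, map_add, map_smul, map_one, heckeGen, heckeOf] using this

lemma heckeGen_braid (i j : Fin M) (hij : (i : ℕ) + 1 = j) :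
    heckeGen q i * heckeGen q j * heckeGen q i = heckeGen q j * heckeGen q i * heckeGen q j := by
  simp only [heckeGen, ← heckeOf_mul, braidGen_braid i j hij]

lemma heckeGen_comm (i j : Fin M) (hij : (i : ℕ) + 1 < j) :
    heckeGen q i * heckeGen q j = heckeGen q j * heckeGen q i := by
  simp only [heckeGen, ← heckeOf_mul, braidGen_comm i j hij]

lemma heckeGen_sub_inv (i : Fin M) : heckeGen q i - heckeGenInv q i = (q - q⁻¹) • 1 := by
  have h1 := congrArg (heckeGenInv q i * ·) (heckeGen_mul_self (q := q) i)
  simp only [← mul_assoc, heckeGenInv_mul, one_mul, mul_add, mul_smul_comm, mul_one] at h1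
  rw [sub_eq_iff_eq_add]; exact h1

lemma isBMWSystem_hecke (hq : q ≠ 0) (hq2 : q ^ 2 ≠ 1) :
    IsBMWSystem q (1 : k) (heckeGen q (M := M)) (heckeGenInv q) 0 where
  q_ne := hq
  q_sq_ne := hq2
  ν_ne := one_ne_zero
  gen_inv := heckeGen_mul_inv
  inv_gen := heckeGenInv_mul
  skein i := by rw [heckeGen_sub_inv, Pi.zero_apply, sub_zero]
  kappa_gen i := by simp
  gen_kappa i := by simp
  tangle i j _ := by simp
  tangle_inv i j _ := by simp
  braid := heckeGen_braid
  comm := heckeGen_comm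
  generic := Or.inl fun _ => rfl

lemma heckeBaxter_eq_baxterize (hq : q ≠ 0) (hq2 : q ^ 2 ≠ 1) (i : Fin M) {x : k} (hx : x ≠ 0) :
    heckeBaxter q i x = baxterize q 1 (heckeGen q i) 0 x := by
  have hl := sub_inv_ne_zero_of_sq_ne_one hq hq2
  have h1 : heckeOf q (braidGen i)⁻¹ = heckeGen q i - (q - q⁻¹) • (1 : HeckeAlg q M) := by
    rw [← heckeGen_sub_inv i]; abel
  rw [heckeBaxter, h1, ← heckeGen, baxterize]
  match_scalars
  · have hl' := sub_ne_zero.mpr hq2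
    rw [sub_inv_eq_div hq]
    field_simp
  · generalize q - q⁻¹ = l at *
    field_simp

lemma heckeShuffle_eq_shuffle (hq : q ≠ 0) (hq2 : q ^ 2 ≠ 1) (n : ℕ) :
    heckeShuffle q n = shuffle q 1 (heckeGen q) 0 := by
  rw [heckeShuffle, shuffle]
  simp only [heckeBaxter_eq_baxterize hq hq2 _ (pow_ne_zero _ hq), Pi.zero_apply]

/-- The universal property of the Hecke algebra. -/
lemma exists_heckeAlg_lift {A : Type*} [Ring A] [Algebra k A] (u : Fin M → Aˣ)
    (hbraid : ∀ i j : Fin M, (i : ℕ) + 1 = j → u i * u j * u i = u j * u i * u j)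
    (hcomm : ∀ i j : Fin M, (i : ℕ) + 1 < j → u i * u j = u j * u i)
    (hquad : ∀ i, (u i : A) * u i = (q - q⁻¹) • (u i : A) + 1) :
    ∃ f : HeckeAlg q M →ₐ[k] A, ∀ i, f (heckeGen q i) = u i := by
  refine ⟨RingQuot.liftAlgHom k ⟨braidRingLift u hbraid hcomm, ?_⟩, fun i => ?_⟩
  · rintro _ _ ⟨i⟩
    rw [map_mul, map_add, map_smul, map_one, braidRingLift_gen, hquad]
  · rw [heckeGen, heckeOf, RingQuot.liftAlgHom_mkAlgHom_apply, braidRingLift_gen]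

/-- The one-dimensional representation `σ_i ↦ q`. -/
lemma exists_heckeAlg_character (hq : q ≠ 0) :
    ∃ χ : HeckeAlg q M →ₐ[k] k, ∀ i, χ (heckeGen q i) = q := by
  refine exists_heckeAlg_lift (fun _ => Units.mk0 q hq) (fun _ _ _ => rfl) (fun _ _ _ => rfl) ?_
  intro i
  simp [sub_mul, hq]

end Hecke

section BMW

variable {k : Type*} [Field k] {q ν : k} {M : ℕ}

/-- The inverse generator of the BMW algebra. -/
noncomputable abbrev bmwGenInv (q ν : k) (i : Fin M) : BMWAlg q ν M :=
  RingQuot.mkAlgHom k (BMWRel q ν M) (toBraidRing k (braidGen i)⁻¹)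

lemma isBMWSystem_bmw (hq : q ≠ 0) (hq2 : q ^ 2 ≠ 1) (hν : ν ≠ 0) (hνq : ν ≠ q)
    (hgen : ∀ i : Fin M, ν ≠ q ^ (2 * (i : ℕ) + 1)) :
    IsBMWSystem q ν (bmwGen q ν (M := M)) (bmwGenInv q ν) (bmwKappa q ν) where
  q_ne := hq
  q_sq_ne := hq2
  ν_ne := hν
  gen_inv i := by
    rw [bmwGen, bmwGenInv, ← map_mul, ← toBraidRing_mul, mul_inv_cancel, toBraidRing_one, map_one]
  inv_gen i := by
    rw [bmwGen, bmwGenInv, ← map_mul, ← toBraidRing_mul, inv_mul_cancel, toBraidRing_one, map_one]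
  skein i := by
    simp only [bmwGen, bmwKappa, braidKappa, map_sub, map_smul, map_one, sub_sub_cancel,
      smul_smul, mul_inv_cancel₀ (sub_inv_ne_zero_of_sq_ne_one hq hq2), one_smul]
  kappa_gen i := by
    simpa only [map_mul, map_smul, bmwGen, bmwKappa] using
      RingQuot.mkAlgHom_rel k (BMWRel.kappa_gen (q := q) (ν := ν) i)
  gen_kappa i := by
    simpa only [map_mul, map_smul, bmwGen, bmwKappa] using
      RingQuot.mkAlgHom_rel k (BMWRel.gen_kappa (q := q) (ν := ν) i)
  tangle i j hij := by
    simpa only [map_mul, map_smul, bmwGen, bmwKappa] using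
      RingQuot.mkAlgHom_rel k (BMWRel.tangle (q := q) (ν := ν) i j hij)
  tangle_inv i j hij := by
    simpa only [map_mul, map_smul, bmwGen, bmwKappa] using
      RingQuot.mkAlgHom_rel k (BMWRel.tangle_inv (q := q) (ν := ν) i j hij)
  braid i j hij := by
    rw [bmwGen, bmwGen]
    simp only [← map_mul (RingQuot.mkAlgHom k (BMWRel q ν M)), ← toBraidRing_mul,
      braidGen_braid i j hij]
  comm i j hij := by
    rw [bmwGen, bmwGen]
    simp only [← map_mul (RingQuot.mkAlgHom k (BMWRel q ν M)), ← toBraidRing_mul,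
      braidGen_comm i j hij]
  generic := Or.inr ⟨hνq, hgen⟩

/-- The Hecke algebra is the quotient of the BMW algebra by the elements `κ_i`. -/
lemma exists_bmwAlg_hom_heckeAlg (hq : q ≠ 0) (hq2 : q ^ 2 ≠ 1) :
    ∃ f : BMWAlg q ν M →ₐ[k] HeckeAlg q M,
      (∀ i, f (bmwGen q ν i) = heckeGen q i) ∧ ∀ i, f (bmwKappa q ν i) = 0 := by
  have hκ : ∀ i : Fin M, RingQuot.mkAlgHom k (HeckeRel q M) (braidKappa q i) = 0 := by
    intro i
    rw [braidKappa, map_sub, map_smul, map_sub, map_one]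
    change 1 - (q - q⁻¹)⁻¹ • (heckeGen q i - heckeGenInv q i) = 0
    rw [heckeGen_sub_inv, smul_smul, inv_mul_cancel₀ (sub_inv_ne_zero_of_sq_ne_one hq hq2),
      one_smul, sub_self]
  refine ⟨RingQuot.liftAlgHom k ⟨RingQuot.mkAlgHom k (HeckeRel q M), ?_⟩, fun i => ?_, fun i => ?_⟩
  · rintro _ _ (i | i | ⟨i, j, hij⟩ | ⟨i, j, hij⟩) <;> simp [hκ]
  · rw [bmwGen, RingQuot.liftAlgHom_mkAlgHom_apply]; rfl
  · rw [bmwKappa, RingQuot.liftAlgHom_mkAlgHom_apply, hκ]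

end BMW

/-! ### The permutation representation of the Hecke algebra -/

section Permutation

variable {k : Type*} [Field k] (q : k) {n : ℕ}

/-- The operator of `σ_{i+1}` on `k^{n+1}`: it acts by `(a, b) ↦ (b, a + (q - q⁻¹) b)` on the
coordinates `i`, `i + 1` and by `q` on the others. -/
def permOp (i : Fin n) : Module.End k (Fin (n + 1) → k) where
  toFun f p := if (p : ℕ) = i then f i.succ else
    if (p : ℕ) = i + 1 then f i.castSucc + (q - q⁻¹) * f i.succ else q * f p
  map_add' f g := by
    ext p; simp only [Pi.add_apply]; split_ifs <;> ring
  map_smul' r f := by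
    ext p; simp only [Pi.smul_apply, smul_eq_mul, RingHom.id_apply]; split_ifs <;> ring

variable {q}

lemma permOp_apply (i : Fin n) (f : Fin (n + 1) → k) (p : Fin (n + 1)) :
    permOp q i f p = if (p : ℕ) = i then f i.succ else
      if (p : ℕ) = i + 1 then f i.castSucc + (q - q⁻¹) * f i.succ else q * f p := rfl

lemma permOp_mul_self (hq : q ≠ 0) (i : Fin n) :
    permOp q i * permOp q i = (q - q⁻¹) • permOp q i + 1 := by
  refine LinearMap.ext fun f => funext fun p => ?_
  simp only [Module.End.mul_apply, LinearMap.add_apply, LinearMap.smul_apply, Pi.add_apply,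
    Pi.smul_apply, Module.End.one_apply, permOp_apply, smul_eq_mul, Fin.val_succ, Fin.val_castSucc]
  by_cases h1 : (p : ℕ) = i
  · obtain rfl : p = i.castSucc := Fin.ext h1
    simp; ring
  by_cases h2 : (p : ℕ) = i + 1
  · obtain rfl : p = i.succ := Fin.ext h2
    simp; ring
  simp only [h1, h2, if_false]
  field_simp
  ring

lemma permOp_braid (hq : q ≠ 0) (i j : Fin n) (hij : (i : ℕ) + 1 = j) :
    permOp q i * permOp q j * permOp q i = permOp q j * permOp q i * permOp q j := by
  have h1 : j.castSucc = i.succ := Fin.ext hij.symm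
  have e1 : (i : ℕ) + 1 + 1 ≠ i := by omega
  refine LinearMap.ext fun f => funext fun p => ?_
  simp only [Module.End.mul_apply, permOp_apply, Fin.val_succ, Fin.val_castSucc, ← hij, h1]
  by_cases hp1 : (p : ℕ) = i
  · simp [hp1, e1, e1.symm]
  by_cases hp2 : (p : ℕ) = i + 1
  · simp [hp2, e1, e1.symm]; ring
  by_cases hp3 : (p : ℕ) = i + 1 + 1
  · simp [hp3, e1, e1.symm]; field_simp; ring
  simp [hp1, hp2, hp3]

lemma permOp_comm (i j : Fin n) (hij : (i : ℕ) + 1 < j) :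
    permOp q i * permOp q j = permOp q j * permOp q i := by
  refine LinearMap.ext fun f => funext fun p => ?_
  simp only [Module.End.mul_apply, permOp_apply, Fin.val_succ, Fin.val_castSucc]
  split_ifs <;> first | omega | ring

end Permutation

/-! ### Lower bound for the degree of the minimal polynomial -/

lemma Module.End.finrank_ker_pow_le {k V : Type*} [Field k] [AddCommGroup V] [Module k V]
    [FiniteDimensional k V] (f : Module.End k V) (m : ℕ) :
    Module.finrank k (LinearMap.ker (f ^ m)) ≤ m * Module.finrank k (LinearMap.ker f) := by
  induction m with
  | zero => simp [LinearMap.ker_eq_bot.mpr (fun _ _ h => h : Function.Injective (1 : Module.End k V))]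
  | succ m ih =>
    set K := LinearMap.ker (f ^ (m + 1)) with hK
    let g : K →ₗ[k] V := (f ^ m).domRestrict K
    have h1 : LinearMap.range g ≤ LinearMap.ker f := by
      rintro _ ⟨⟨x, hx⟩, rfl⟩
      rw [hK, LinearMap.mem_ker, pow_succ', Module.End.mul_apply] at hx
      exact hx
    have h2 : (LinearMap.ker g).map K.subtype ≤ LinearMap.ker (f ^ m) := by
      rintro _ ⟨x, hx, rfl⟩
      exact hx
    have h3 := Submodule.finrank_mono h1
    have h4 := Submodule.finrank_mono h2
    rw [Submodule.finrank_map_subtype_eq] at h4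
    have h5 := LinearMap.finrank_range_add_finrank_ker g
    rw [add_mul, one_mul]
    omega

section Nonvanishing

variable {k : Type*} [Field k] {q : k} {n : ℕ}

lemma qNum_ne_zero_of_qFact_ne_zero {m j : ℕ} (h : qFact q m ≠ 0) (h1 : 1 ≤ j) (h2 : j ≤ m) :
    qNum q j ≠ 0 :=
  Finset.prod_ne_zero_iff.mp h j (Finset.mem_Icc.mpr ⟨h1, h2⟩)

/-- In the Hecke algebra `σ_i(q ^ m)` has the eigenvalues `[m + 1]_q` and `-[m - 1]_q`. -/
lemma isUnit_baxterize_hecke (hq : q ≠ 0) (hq2 : q ^ 2 ≠ 1) (i : Fin n) (m : ℕ)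
    (h1 : qNum q m ≠ 0) (h2 : qNum q (m + 2) ≠ 0) :
    IsUnit (baxterize q 1 (heckeGen q i) 0 (q ^ (m + 1))) := by
  have hl := sub_ne_zero.mpr hq2
  have hx : q ^ m ≠ 0 := pow_ne_zero _ hq
  set x := q ^ (m + 1) with hxdef
  set α := (x - x⁻¹) / (q - q⁻¹) with hα
  have hx0 : x ≠ 0 := pow_ne_zero _ hq
  have hb : baxterize q 1 (heckeGen q i) 0 x = x⁻¹ • 1 + α • heckeGen q i := by
    rw [baxterize, smul_zero, add_zero, smul_add, smul_smul]
    congr 2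
    rw [hα]
    field_simp
  have hα2 : 1 - α ^ 2 = -(qNum q m * qNum q (m + 2)) := by
    rw [hα, hxdef, qNum, qNum, sub_inv_eq_div hq, pow_succ, pow_add]
    field_simp
    ring
  have hne : 1 - α ^ 2 ≠ 0 := by
    rw [hα2]; exact neg_ne_zero.mpr (mul_ne_zero h1 h2)
  have hαl : α * (q - q⁻¹) = x - x⁻¹ :=
    div_mul_cancel₀ _ (sub_inv_ne_zero_of_sq_ne_one hq hq2)
  have hxx : x⁻¹ * x = 1 := inv_mul_cancel₀ hx0
  clear_value α x
  have e1 : (x⁻¹ • 1 + α • heckeGen q i) * (x • 1 - α • heckeGen q i) = (1 - α ^ 2) • 1 := by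
    simp only [mul_smul_comm, smul_mul_assoc, add_mul, mul_sub, mul_one, one_mul,
      heckeGen_mul_self]
    match_scalars
    · linear_combination hxx
    · linear_combination (-α) * hαl
  have e2 : (x • 1 - α • heckeGen q i) * (x⁻¹ • 1 + α • heckeGen q i) = (1 - α ^ 2) • 1 := by
    simp only [mul_smul_comm, smul_mul_assoc, sub_mul, mul_add, mul_one, one_mul,
      heckeGen_mul_self]
    match_scalars
    · linear_combination hxx
    · linear_combination (-α) * hαl
  rw [hb]
  refine isUnit_iff_exists.mpr ⟨(1 - α ^ 2)⁻¹ • (x • 1 - α • heckeGen q i), ?_, ?_⟩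
  · rw [mul_smul_comm, e1, smul_smul, inv_mul_cancel₀ hne, one_smul]
  · rw [smul_mul_assoc, e2, smul_smul, inv_mul_cancel₀ hne, one_smul]

lemma baxterize_permOp_apply (hq : q ≠ 0) (hq2 : q ^ 2 ≠ 1) (i : Fin n) (f : Fin (n + 1) → k)
    (p : Fin (n + 1)) :
    baxterize q 1 (permOp q i) 0 q f p = q⁻¹ * f p + permOp q i f p := by
  have hl := sub_ne_zero.mpr hq2
  simp only [baxterize, smul_zero, add_zero, LinearMap.smul_apply, LinearMap.add_apply,
    Module.End.one_apply, Pi.smul_apply, Pi.add_apply, smul_eq_mul, sub_inv_eq_div hq]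
  field_simp

/-- The kernel of `σ_1(q)` in the permutation representation is at most a line, parametrized by
the first coordinate. -/
lemma eq_zero_of_baxterize_permOp {m : ℕ} (hq : q ≠ 0) (hq2 : q ^ 2 ≠ 1) (h2 : qNum q 2 ≠ 0)
    {f : Fin (m + 1 + 1) → k} (hf : baxterize q 1 (permOp q (0 : Fin (m + 1))) 0 q f = 0)
    (h0 : f 0 = 0) : f = 0 := by
  have hl := sub_ne_zero.mpr hq2
  have h2' : q⁻¹ + q ≠ 0 := by
    convert h2 using 1
    rw [qNum, sub_inv_eq_div hq]
    field_simp
    ring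
  have h (p) := congrFun hf p
  simp only [baxterize_permOp_apply hq hq2, permOp_apply, Pi.zero_apply] at h
  have h1 : f 1 = 0 := by
    have := h 0
    simpa [h0] using this
  funext p
  refine Fin.cases h0 (fun p => ?_) p
  refine Fin.cases h1 (fun p => ?_) p
  have := h p.succ.succ
  rw [if_neg (by simp), if_neg (by simp), ← add_mul] at this
  exact (mul_eq_zero.mp this).resolve_left h2'

lemma eq_zero_of_permOp_eigen {f : Fin (n + 1) → k} (hf : ∀ i, permOp q i f = q • f)
    (h0 : f 0 = 0) : f = 0 := by
  funext p
  induction p using Fin.induction with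
  | zero => exact h0
  | succ i ih =>
    have := congrFun (hf i) i.castSucc
    rw [permOp_apply, if_pos (Fin.val_castSucc i), Pi.smul_apply, ih] at this
    simpa using this

lemma exists_permRepresentation (hq : q ≠ 0) :
    ∃ ρ : HeckeAlg q n →ₐ[k] Module.End k (Fin (n + 1) → k),
      ∀ i, ρ (heckeGen q i) = permOp q i := by
  have hinv (i : Fin n) : permOp q i * (permOp q i - (q - q⁻¹) • 1) = 1 := by
    rw [mul_sub, permOp_mul_self hq, mul_smul_comm, mul_one, add_sub_cancel_left]
  have hinv' (i : Fin n) : (permOp q i - (q - q⁻¹) • 1) * permOp q i = 1 := by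
    rw [sub_mul, permOp_mul_self hq, smul_mul_assoc, one_mul, add_sub_cancel_left]
  exact exists_heckeAlg_lift (fun i => ⟨permOp q i, _, hinv i, hinv' i⟩)
    (fun i j hij => Units.ext (permOp_braid hq i j hij))
    (fun i j hij => Units.ext (permOp_comm i j hij)) (permOp_mul_self hq)

/-- In the permutation representation of dimension `n + 1` the shuffle element `T` has a kernel
of dimension at most one, since `σ_2(q²), …, σ_n(qⁿ)` are invertible. If `T ^ (n - 1)` were killed
by `T - [n + 1]_q!`, its image would consist of invariants and have dimension at most one, while
its kernel has dimension at most `n - 1`. -/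
lemma hecke_shuffle_pow_mul_sub_ne_zero (hq : q ≠ 0) (hq2 : q ^ 2 ≠ 1)
    (hc : qFact q (n + 1) ≠ 0) (hn : 0 < n) :
    shuffle q 1 (heckeGen q (M := n)) 0 ^ (n - 1) *
      (shuffle q 1 (heckeGen q (M := n)) 0 - algebraMap k (HeckeAlg q n) (qFact q (n + 1))) ≠ 0 := by
  obtain ⟨m, rfl⟩ := Nat.exists_eq_add_one_of_ne_zero hn.ne'
  rw [Nat.add_sub_cancel]
  have hsys := isBMWSystem_hecke (M := m + 1) hq hq2
  obtain ⟨ρ, hρ⟩ := exists_permRepresentation (n := m + 1) hq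
  set T := shuffle q 1 (heckeGen q (M := m + 1)) 0 with hT
  intro h0
  -- `T ^ m` is proportional to `T ^ (m + 1)`, hence already a `q`-eigenvector of all generators
  have heig : ∀ i, heckeGen q i * T ^ m = q • T ^ m := by
    intro i
    rw [mul_sub, ← pow_succ, ← Algebra.commutes, ← Algebra.smul_def, sub_eq_zero] at h0
    have h1 := hsys.gen_mul_shuffle_pow (m + 1) i i.2
    rw [← hT, h0, mul_smul_comm, smul_comm q] at h1
    exact smul_right_injective _ hc h1
  -- evaluation at the first coordinate is injective on the image of `T ^ m`
  have hrange : Module.finrank k (LinearMap.range (ρ T ^ m)) ≤ 1 := by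
    have := LinearMap.finrank_le_finrank_of_injective
      (f := (LinearMap.proj (R := k) (φ := fun _ : Fin (m + 1 + 1) => k) 0).comp
        (LinearMap.range (ρ T ^ m)).subtype) (by
        rw [← LinearMap.ker_eq_bot, LinearMap.ker_eq_bot']
        rintro ⟨_, f, rfl⟩ hf
        refine Subtype.ext (eq_zero_of_permOp_eigen (q := q) (fun i => ?_) hf)
        have := LinearMap.congr_fun (congrArg ρ (heig i)) f
        simp only [map_mul, map_smul, map_pow, hρ] at this
        exact this)
    simpa using this
  -- the factors of `T` after the first are invertible
  have hker : Module.finrank k (LinearMap.ker (ρ T)) ≤ 1 := by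
    obtain ⟨R, hR, hTR⟩ : ∃ R, IsUnit R ∧ T = baxterize q 1 (heckeGen q 0) 0 q * R := by
      refine ⟨(List.ofFn fun i : Fin m =>
        baxterize q 1 (heckeGen q i.succ) 0 (q ^ ((i : ℕ) + 1 + 1))).prod, List.prod_isUnit ?_, by
        rw [hT, shuffle, List.ofFn_succ, List.prod_cons, Fin.val_zero, zero_add, pow_one]; rfl⟩
      intro x hx
      obtain ⟨i, rfl⟩ := List.mem_ofFn.mp hx
      refine isUnit_baxterize_hecke hq hq2 _ _ ?_ ?_ <;>
        refine qNum_ne_zero_of_qFact_ne_zero hc ?_ ?_ <;> (simp; try omega)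
    have hinj : ∀ f, ρ R f = 0 → f = 0 := by
      obtain ⟨R', -, hR'⟩ := isUnit_iff_exists.mp hR
      intro f hf
      have := LinearMap.congr_fun (congrArg ρ hR') f
      rw [map_mul, map_one, Module.End.mul_apply, hf, map_zero] at this
      exact this.symm
    have hρb : ρ (baxterize q 1 (heckeGen q 0) 0 q) = baxterize q 1 (permOp q 0) 0 q := by
      simp only [baxterize, map_smul, map_add, map_one, map_zero, hρ]
    have := LinearMap.finrank_le_finrank_of_injective
      (f := ((LinearMap.proj (R := k) (φ := fun _ : Fin (m + 1 + 1) => k) 0).comp (ρ R)).comp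
        (LinearMap.ker (ρ T)).subtype) (by
        rw [← LinearMap.ker_eq_bot, LinearMap.ker_eq_bot']
        rintro ⟨f, hf⟩ hf0
        rw [LinearMap.mem_ker, hTR, map_mul, hρb, Module.End.mul_apply] at hf
        have h2 := qNum_ne_zero_of_qFact_ne_zero hc (j := 2) (by omega) (by omega)
        exact Subtype.ext (hinj f (eq_zero_of_baxterize_permOp hq hq2 h2 hf hf0)))
    simpa using this
  have h1 := LinearMap.finrank_range_add_finrank_ker (ρ T ^ m)
  have h2 := (Module.End.finrank_ker_pow_le (ρ T) m).trans (Nat.mul_le_mul_left m hker)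
  rw [Module.finrank_fin_fun] at h1
  omega

end Nonvanishing

open Polynomial in
theorem mainTheorem5 {k : Type*} [Field k] (q : k) (hq : q ≠ 0) (hq2 : q ^ 2 ≠ 1) (n : ℕ) :
    -- Hecke algebras
    (heckeShuffle q n ^ n *
        (heckeShuffle q n - algebraMap k (HeckeAlg q n) (qFact q (n + 1))) = 0 ∧
      (qFact q (n + 1) ≠ 0 →
        minpoly k (heckeShuffle q n) = X ^ n * (X - C (qFact q (n + 1))) ∧
        (1 < n → ¬ IsSemisimpleElt k (heckeShuffle q n)) ∧
        (∃! S : HeckeAlg q n, IsSymmetrizer q (heckeGen q) S) ∧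
        (∀ S : HeckeAlg q n, IsSymmetrizer q (heckeGen q) S →
          ∀ s : HeckeAlg q n,
            IsSemisimplePart k (heckeShuffle q n) s ↔ s = qFact q (n + 1) • S) ∧
        IsSimpleEigenvalue k (heckeShuffle q n) (qFact q (n + 1)))) ∧
    -- BMW algebras
    (∀ ν : k, ν ≠ 0 → ν ≠ q → ν ≠ -q⁻¹ →
      (∀ j ∈ Finset.Icc 1 n, ν ≠ q ^ (2 * j - 1)) →
      bmwShuffle q ν n ^ n *
        (bmwShuffle q ν n - algebraMap k (BMWAlg q ν n) (qFact q (n + 1))) = 0 ∧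
      (qFact q (n + 1) ≠ 0 →
        minpoly k (bmwShuffle q ν n) = X ^ n * (X - C (qFact q (n + 1))) ∧
        (1 < n → ¬ IsSemisimpleElt k (bmwShuffle q ν n)) ∧
        (∃! S : BMWAlg q ν n, IsSymmetrizer q (bmwGen q ν) S) ∧
        (∀ S : BMWAlg q ν n, IsSymmetrizer q (bmwGen q ν) S →
          ∀ s : BMWAlg q ν n,
            IsSemisimplePart k (bmwShuffle q ν n) s ↔ s = qFact q (n + 1) • S) ∧
        IsSimpleEigenvalue k (bmwShuffle q ν n) (qFact q (n + 1)))) := by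
  constructor
  · obtain ⟨χ, hχ⟩ := exists_heckeAlg_character (M := n) hq
    rw [heckeShuffle_eq_shuffle hq hq2]
    exact (isBMWSystem_hecke hq hq2).shuffle_spectral χ hχ
      (adjoin_braidGen_eq_top _ (RingQuot.mkAlgHom_surjective k _))
      (hecke_shuffle_pow_mul_sub_ne_zero hq hq2)
  · intro ν hν hνq _ hgen
    have hsys : IsBMWSystem q ν (bmwGen q ν (M := n)) (bmwGenInv q ν) (bmwKappa q ν) :=
      isBMWSystem_bmw hq hq2 hν hνq fun i => by
        have := hgen (i + 1) (Finset.mem_Icc.mpr ⟨by omega, i.2⟩)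
        rwa [show 2 * ((i : ℕ) + 1) - 1 = 2 * (i : ℕ) + 1 by omega] at this
    obtain ⟨χ, hχ⟩ := exists_heckeAlg_character (M := n) hq
    obtain ⟨π, hπ, hπκ⟩ := exists_bmwAlg_hom_heckeAlg (ν := ν) (M := n) hq hq2
    have hπT : π (bmwShuffle q ν n) = shuffle q 1 (heckeGen q) 0 := by
      rw [bmwShuffle, shuffle, map_list_prod, List.map_ofFn]
      congr 2
      funext i
      simp [bmwBaxter, baxterize, hπ, hπκ]
    refine hsys.shuffle_spectral (χ.comp π) (fun i => by rw [AlgHom.comp_apply, hπ, hχ])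
      (adjoin_braidGen_eq_top _ (RingQuot.mkAlgHom_surjective k _)) fun hc hn h0 => ?_
    refine hecke_shuffle_pow_mul_sub_ne_zero hq hq2 hc hn ?_
    rw [← hπT, ← AlgHom.commutes π, ← map_sub, ← map_pow, ← map_mul]
    exact (congrArg π h0).trans (map_zero π)
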